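/- Let $n\ge 1$, let $M(n)$ be the space of complex $n\times n$ matrices and $P(n)$ the algebra of polynomial functions on it, with the Poisson bracket determined by $[\alpha_{ij},\alpha_{st}]=\delta_{js}\alpha_{it}-\delta_{it}\alpha_{sj}$ for the entry functions $\alpha_{ij}$. For $p\in P(n)$ let $\xi_p$ be the vector field on $M(n)$ with $\xi_p q=[p,q]$ for all $q\in P(n)$. For $1\le m\le n$ let $x_m$ be the upper left $m\times m$ block of $x$, and regard $P(m)\subseteq P(n)$ through $x\mapsto x_m$. Let $J(n)\subseteq P(n)$ be the subalgebra generated by the invariants $P(m)^{Gl(m)}$, $1\le m\le n$, of the adjoint actions, and put $V_x=\{(\xi_p)_x : p\in J(n)\}$ and $d(k)=k(k+1)/2$. For $1\le k\le m\le n$ let $f_{(k,m)}(x)=\frac1{m+1-k}\operatorname{tr}\,(x_m)^{m+1-k}$, let $f_{k,m}(x)$ be the elementary symmetric function of degree $m-k+1$ in the eigenvalues of $x_m$ (with multiplicity), and for $c=(c_{k,m})\in\mathbb C^{d(n)}$ let $M_c(n)=\{x : f_{k,m}(x)=c_{k,m}\text{ for all }1\le k\le m\le n\}$. A leaf of $x\mapsto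 V_x$ is a (possibly only injectively immersed) complex analytic submanifold $X$ of $M(n)$ with $T_x(X)=V_x$ for all $x\in X$. A finite-dimensional commutative Lie algebra $\mathfrak g$ of vector fields on $M(n)$ integrates to an action of the simply connected complex Lie group $G$ (isomorphic to the vector group $\mathfrak g$) with Lie algebra $\mathfrak g$ if there is a holomorphic action of $G$ on $M(n)$ with $\frac{d}{dz}\big|_{z=0}\exp(z\xi)\cdot x=\xi_x$ for all $\xi\in\mathfrak g$, $x\in M(n)$. Theorem. (1) $J(n)$ is a maximal Poisson commutative subalgebra of $P(n)$: $[p,q]=0$ for all $p,q\in J(n)$, and every $f\in P(n)$ with $[f,p]=0$ for all $p\in J(n)$ lies in $J(n)$. (2) The span $\mathfrak a$ of the fields $\xi_{f_{(k,m)}}$, $1\le k\le m\le n$, is a commutative Lie algebra of dimension $d(n-1)$, and it integrates to a holomorphic action on $M(n)$ of the simply connected group $A\cong\mathbb C^{d(n-1)}$ with Lie algebra $\mathfrak a$. Every $A$-orbit is a leaf of $x\mapsto V_x$, and $A$ preserves $M_c(n)$ for every $c\in\mathbb C^{d(n)}$. There is an $(n-1)$-dimensional vector subgroup of $A$ whose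 elements act on $M(n)$ precisely as the maps $x\mapsto gxg^{-1}$, $g$ an invertible diagonal matrix. (3) For every $p\in J(n)$ the field $\xi_p$ is globally integrable: it is the velocity field of a holomorphic action of $\mathbb C$ on $M(n)$. This action commutes with $A$ and preserves every $A$-orbit and every $M_c(n)$. (4) Let $p'_1,\dots,p'_d$ be any finite family generating the algebra $J(n)$. Then the span $\mathfrak a'$ of the fields $\xi_{p'_i}$ is a commutative Lie algebra, which integrates to a holomorphic action on $M(n)$ of the simply connected group $A'$ with Lie algebra $\mathfrak a'$. The action of $A'$ commutes with that of $A$, and the orbits of $A'$ are the same as the orbits of $A$; in particular they are leaves of $x\mapsto V_x$. -/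

import Mathlib

open scoped Manifold ContDiff

namespace GelfandZeitlin

noncomputable section

/-- `M(n)`: complex `n × n` matrices, as the normed space (hence complex manifold) of families of
entries `x i j`. The pointwise product of this function type is never used: for matrix products
we go to `Matrix (Fin n) (Fin n) ℂ` by `Matrix.of`. -/
abbrev Mat (n : ℕ) : Type := Fin n → Fin n → ℂ

/-- The adjoint action of `Gl(n)` on `M(n)`: `Ad g (x) = g x g⁻¹`. -/
def Ad {n : ℕ} (g : GL (Fin n) ℂ) (x : Mat n) : Mat n :=
  Matrix.of.symm ((g : Matrix (Fin n) (Fin n) ℂ) * Matrix.of x *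
    ((g⁻¹ : GL (Fin n) ℂ) : Matrix (Fin n) (Fin n) ℂ))

/-- `P(n)`: polynomial functions on `M(n)`; the variable `(i, j)` is the entry function `α_ij`. -/
abbrev Poly (n : ℕ) : Type := MvPolynomial (Fin n × Fin n) ℂ

/-- The value of `p ∈ P(n)` at `x ∈ M(n)`. -/
def evalAt {n : ℕ} (x : Mat n) (p : Poly n) : ℂ :=
  MvPolynomial.eval (fun ij : Fin n × Fin n => x ij.1 ij.2) p

/-- The bracket of entry functions, `[α_ij, α_st] = δ_js α_it - δ_it α_sj`. -/
def coordBracket {n : ℕ} (a b : Fin n × Fin n) : Poly n :=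
  (if a.2 = b.1 then MvPolynomial.X (a.1, b.2) else 0) -
    (if a.1 = b.2 then MvPolynomial.X (b.1, a.2) else 0)

/-- The Poisson bracket `[p, q]` on `P(n)`: the biderivation extending `coordBracket`. -/
def poisson {n : ℕ} (p q : Poly n) : Poly n :=
  ∑ a : Fin n × Fin n, ∑ b : Fin n × Fin n,
    MvPolynomial.pderiv a p * MvPolynomial.pderiv b q * coordBracket a b

/-- A vector field on `M(n)`, every tangent space being identified with `M(n)`. -/
abbrev VField (n : ℕ) : Type := Mat n → Mat n

/-- The Hamiltonian vector field `ξ_p`, with `ξ_p q = [p, q]`: its component along the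
coordinate `α_st` is the function `[p, α_st]`. -/
def ham {n : ℕ} (p : Poly n) : VField n :=
  fun x s t => evalAt x (poisson p (MvPolynomial.X (s, t)))

/-- The upper left `m × m` block `x_m` of `x`. -/
def cutoff {n m : ℕ} (h : m ≤ n) (x : Mat n) : Matrix (Fin m) (Fin m) ℂ :=
  (Matrix.of x).submatrix (Fin.castLE h) (Fin.castLE h)

/-- The inclusion `P(m) ⊆ P(n)` dual to `x ↦ x_m`. -/
def incl {n m : ℕ} (h : m ≤ n) : Poly m →ₐ[ℂ] Poly n :=
  MvPolynomial.rename (Prod.map (Fin.castLE h) (Fin.castLE h))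

/-- `p ∈ P(m)` is invariant under the adjoint action of `Gl(m)`. -/
def IsAdInvariant {m : ℕ} (p : Poly m) : Prop :=
  ∀ (g : GL (Fin m) ℂ) (x : Mat m), evalAt (Ad g x) p = evalAt x p

/-- `J(n)`: the subalgebra of `P(n)` generated by `P(m)^{Gl(m)}`, `1 ≤ m ≤ n`. -/
def J (n : ℕ) : Subalgebra ℂ (Poly n) :=
  Algebra.adjoin ℂ {p : Poly n | ∃ (m : ℕ) (_ : 1 ≤ m) (h : m ≤ n) (q : Poly m),
    IsAdInvariant q ∧ p = incl h q}

/-- `f_{(k,m)}(x) = tr (x_m)^{m+1-k} / (m+1-k)`, for `1 ≤ k ≤ m ≤ n`. -/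
def tracePoly {n : ℕ} (k m : ℕ) (h : m ≤ n) : Poly n :=
  incl h (MvPolynomial.C (1 / ((m + 1 - k : ℕ) : ℂ)) *
    (Matrix.mvPolynomialX (Fin m) (Fin m) ℂ ^ (m + 1 - k)).trace)

/-- `𝔞`: the span of the fields `ξ_{f_(k,m)}`, `1 ≤ k ≤ m ≤ n`. -/
def lieA (n : ℕ) : Submodule ℂ (VField n) :=
  Submodule.span ℂ {ξ : VField n | ∃ (k m : ℕ) (h : m ≤ n), 1 ≤ k ∧ k ≤ m ∧
    ξ = ham (tracePoly k m h)}

/-- The set of pairs `(k, m)` with `1 ≤ k ≤ m ≤ n`; it has `d(n) = n(n+1)/2` elements. -/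
abbrev Index (n : ℕ) : Type := {km : ℕ × ℕ // 1 ≤ km.1 ∧ km.1 ≤ km.2 ∧ km.2 ≤ n}

/-- `Φ_n`, with components `f_{k,m}(x)`, the elementary symmetric function of degree `m-k+1` in
the eigenvalues of `x_m`:
`det (λ - x_m) = λ^m + ∑ k ∈ {1, …, m}, (-1)^(m-k+1) * f_{k,m}(x) * λ^(k-1)`. -/
def Phi {n : ℕ} (x : Mat n) : Index n → ℂ :=
  fun i => (-1) ^ (i.1.2 - i.1.1 + 1) * (cutoff i.2.2.2 x).charpoly.coeff (i.1.1 - 1)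

/-- The fiber `M_c(n)` of `Φ_n`. -/
def fiber {n : ℕ} (c : Index n → ℂ) : Set (Mat n) := {x | Phi x = c}

/-- `V_x = {(ξ_p)_x : p ∈ J(n)}`. -/
def V {n : ℕ} (x : Mat n) : Set (Mat n) := {v | ∃ p ∈ J n, ham p x = v}

/-- `X ⊆ M(n)` is a leaf of `x ↦ V_x`: it is an (injectively immersed) complex analytic
submanifold `ι : Q → M(n)` with `T_x(X) = V_x` for all `x ∈ X`. -/
def IsLeaf {n : ℕ} (X : Set (Mat n)) : Prop :=
  ∃ (r : ℕ) (Q : Type) (_ : TopologicalSpace Q) (_ : ChartedSpace (Fin r → ℂ) Q)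
    (ι : Q → Mat n),
    T2Space Q ∧ SecondCountableTopology Q ∧ IsManifold 𝓘(ℂ, Fin r → ℂ) ω Q ∧
    ContMDiff 𝓘(ℂ, Fin r → ℂ) 𝓘(ℂ, Mat n) ω ι ∧
    Function.Injective ι ∧ Set.range ι = X ∧
    ∀ q : Q,
      Function.Injective (mfderiv 𝓘(ℂ, Fin r → ℂ) 𝓘(ℂ, Mat n) ι q) ∧
      Set.range (mfderiv 𝓘(ℂ, Fin r → ℂ) 𝓘(ℂ, Mat n) ι q) = V (ι q)

/-- `σ` is a holomorphic action on `M(n)` of the simply connected commutative group `ℂ^r` which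
integrates the space `𝔤` of vector fields, where `e` identifies the Lie algebra `ℂ^r` of the
group with `𝔤`: the one-parameter group `z ↦ σ (z a)` has velocity field `e a`. -/
structure Integrates {n r : ℕ} (𝔤 : Submodule ℂ (VField n)) (e : (Fin r → ℂ) ≃ₗ[ℂ] 𝔤)
    (σ : (Fin r → ℂ) → Mat n → Mat n) : Prop where
  zero : ∀ x, σ 0 x = x
  add : ∀ a b x, σ (a + b) x = σ a (σ b x)
  holo : AnalyticOnNhd ℂ (fun q : (Fin r → ℂ) × Mat n => σ q.1 q.2) Set.univ
  deriv : ∀ a x, HasDerivAt (fun z : ℂ => σ (z • a) x) ((e a : VField n) x) 0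

/-- `φ` is a global holomorphic flow (an action of `ℂ`) on `M(n)` with velocity field `ξ`. -/
structure IsFlow {n : ℕ} (ξ : VField n) (φ : ℂ → Mat n → Mat n) : Prop where
  zero : ∀ x, φ 0 x = x
  add : ∀ s t x, φ (s + t) x = φ s (φ t x)
  holo : AnalyticOnNhd ℂ (fun q : ℂ × Mat n => φ q.1 q.2) Set.univ
  deriv : ∀ x, HasDerivAt (fun z : ℂ => φ z x) (ξ x) 0

/-- The orbit of `x` under the action `σ`. -/
def orbit {n r : ℕ} (σ : (Fin r → ℂ) → Mat n → Mat n) (x : Mat n) : Set (Mat n) :=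
  Set.range fun a => σ a x

end

end GelfandZeitlin

open GelfandZeitlin

/-!
Write `x_m` for the upper left `m × m` block of `x`, extended by zero to an `n × n` matrix when
necessary. With the trace form the gradient of `f_(m-j,m)` at `x` is `x_m ^ j`, and the Hamiltonian
field of any `p` is the commutator of `grad p` with `x` (`ham_eq_grad`, `ham_tracePoly`). Hence the
field of `f_(m-j,m)` integrates to conjugation by `exp (z x_m ^ j)` (`flow`). Along this flow the
blocks of size at most `m` are constant and the larger ones are conjugated, so the flows commute
(`flow_comm`) and preserve all traces `tr (x_l ^ k)`. For `m = n` the field is zero.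

**Generators of `J(n)`.** An invariant polynomial takes the same value at `x` and at the companion
matrix of the characteristic polynomial of `x`, because this holds when the first basis vector is
cyclic (`IsAdInvariant.eq_aeval_companionOf`). So it is a polynomial in the coefficients of the
characteristic polynomial and, by Newton's identities, in the traces of powers
(`J_le_adjoin_tracePoly`). Consequently functions in `J(n)` are constant along the flows, `J(n)` is
Poisson commutative, and `ξ_p` for `p ∈ J(n)` is a combination of the basis fields with coefficients
in `J(n)` (`exists_ham_eq_sum`).

**Dimension and maximality.** At the shift matrix (ones just below the diagonal) the basis fields
are, up to sign, exactly the matrix units below the diagonal (`ham_basisPoly_shift`). This gives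
their linear independence, and also that the Hessenberg matrices `shift + upper triangular` sweep
out an open set under the action (`map_nhds_shift`). On the Hessenberg matrices the coefficients of
the characteristic polynomials of the leading blocks are polynomial coordinates
(`hessenberg_entry_mem`), so any `f` agrees there with some `g ∈ J(n)`. If `f` Poisson commutes with
`J(n)`, then `f - g` vanishes on an open set (`mem_J_of_poisson_eq_zero`).

**Actions and orbits.** The commuting flows give an action of `ℂ^{d(n-1)}`. Since the coefficients in
`J(n)` are constant on orbits, the fields of any finite family in `J(n)` integrate to a
reparametrization of this action (`IsBasisAction.exists_reparametrization`), with the same orbits if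
the family generates `J(n)` (`IsBasisAction.range_eq_of_reparametrization`). An orbit is the
injectively immersed quotient of a complement of the infinitesimal stabilizer by a discrete group
(`IsHolAction.isLeaf_range`). The powers `j = 0` give conjugation by diagonal matrices
(`IsBasisAction.torusDirection_apply`, `exists_torusElement`).
-/

namespace GelfandZeitlin

/-! ### Hamiltonian fields as commutators with gradients -/

/-- The gradient of `p` at `x` with respect to the trace form: `d p (v) = tr (grad p x * v)`. -/
noncomputable def grad {n : ℕ} (p : Poly n) (x : Mat n) : Matrix (Fin n) (Fin n) ℂ :=
  Matrix.of fun j i => evalAt x (MvPolynomial.pderiv (i, j) p)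

theorem evalAt_add {n : ℕ} (x : Mat n) (p q : Poly n) :
    evalAt x (p + q) = evalAt x p + evalAt x q := map_add _ _ _

theorem evalAt_mul {n : ℕ} (x : Mat n) (p q : Poly n) :
    evalAt x (p * q) = evalAt x p * evalAt x q := map_mul _ _ _

theorem evalAt_sum {n : ℕ} {ι : Type*} (x : Mat n) (s : Finset ι) (p : ι → Poly n) :
    evalAt x (∑ i ∈ s, p i) = ∑ i ∈ s, evalAt x (p i) := map_sum _ _ _

theorem evalAt_C {n : ℕ} (x : Mat n) (c : ℂ) : evalAt x (MvPolynomial.C c) = c :=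
  MvPolynomial.eval_C _

theorem evalAt_X {n : ℕ} (x : Mat n) (a : Fin n × Fin n) :
    evalAt x (MvPolynomial.X a) = x a.1 a.2 := MvPolynomial.eval_X _

theorem eq_of_evalAt {n : ℕ} {p q : Poly n} (h : ∀ x : Mat n, evalAt x p = evalAt x q) :
    p = q :=
  MvPolynomial.funext fun v => h fun i j => v (i, j)

/-- The Hamiltonian field of `p` is the commutator of its gradient with the point. -/
theorem ham_eq_grad {n : ℕ} (p : Poly n) (x : Mat n) :
    Matrix.of (ham p x) = grad p x * Matrix.of x - Matrix.of x * grad p x := by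
  ext s t
  have h1 : ham p x s t = ∑ a : Fin n × Fin n, evalAt x (MvPolynomial.pderiv a p) *
      evalAt x (coordBracket a (s, t)) := by
    simp only [ham, poisson, evalAt_sum, evalAt_mul, MvPolynomial.pderiv_X]
    refine Finset.sum_congr rfl fun a _ => ?_
    rw [Finset.sum_eq_single (s, t)]
    · simp [evalAt]
    · intro b _ hb
      simp [hb.symm, evalAt]
    · simp
  rw [Matrix.of_apply, h1]
  simp only [coordBracket, evalAt, map_sub, mul_sub, Finset.sum_sub_distrib, Matrix.sub_apply,
    Matrix.mul_apply, grad, Matrix.of_apply]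
  congr 1
  · rw [Fintype.sum_prod_type]
    refine Finset.sum_congr rfl fun i _ => ?_
    simp [apply_ite (MvPolynomial.eval _)]
  · rw [Fintype.sum_prod_type_right]
    refine Finset.sum_congr rfl fun j _ => ?_
    simp [apply_ite (MvPolynomial.eval _), mul_comm]

theorem grad_add {n : ℕ} (p q : Poly n) (x : Mat n) : grad (p + q) x = grad p x + grad q x := by
  ext i j; simp [grad, evalAt]

theorem grad_mul {n : ℕ} (p q : Poly n) (x : Mat n) :
    grad (p * q) x = evalAt x p • grad q x + evalAt x q • grad p x := by
  ext i j; simp [grad, evalAt]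

theorem grad_C {n : ℕ} (c : ℂ) (x : Mat n) : grad (MvPolynomial.C c) x = 0 := by
  ext i j; simp [grad, evalAt]

theorem grad_smul {n : ℕ} (c : ℂ) (p : Poly n) (x : Mat n) : grad (c • p) x = c • grad p x := by
  ext i j; simp [grad, evalAt]

theorem ham_add {n : ℕ} (p q : Poly n) : ham (p + q) = ham p + ham q := by
  funext x
  apply Matrix.of.injective
  rw [ham_eq_grad, grad_add, Pi.add_apply, ← Matrix.of_add_of, ham_eq_grad, ham_eq_grad]
  noncomm_ring

theorem ham_mul {n : ℕ} (p q : Poly n) (x : Mat n) :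
    ham (p * q) x = evalAt x p • ham q x + evalAt x q • ham p x := by
  apply Matrix.of.injective
  rw [ham_eq_grad, grad_mul, ← Matrix.of_add_of, ← Matrix.smul_of, ← Matrix.smul_of, ham_eq_grad,
    ham_eq_grad]
  simp only [add_mul, mul_add, smul_mul_assoc, mul_smul_comm, smul_sub]
  abel

theorem ham_C {n : ℕ} (c : ℂ) : ham (MvPolynomial.C c : Poly n) = 0 := by
  funext x
  apply Matrix.of.injective
  rw [ham_eq_grad, grad_C]; simp

theorem ham_smul {n : ℕ} (c : ℂ) (p : Poly n) : ham (c • p) = c • ham p := by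
  funext x
  apply Matrix.of.injective
  rw [ham_eq_grad, grad_smul, Pi.smul_apply, ← Matrix.smul_of, ham_eq_grad]
  simp [smul_sub]

/-- `p ↦ ξ_p` as a linear map. -/
noncomputable def hamL (n : ℕ) : Poly n →ₗ[ℂ] VField n where
  toFun := ham
  map_add' := ham_add
  map_smul' := ham_smul

theorem hamL_apply {n : ℕ} (p : Poly n) : hamL n p = ham p := rfl

/-- The entry function `α_a` as a continuous linear form. -/
noncomputable def coord {n : ℕ} (a : Fin n × Fin n) : Mat n →L[ℂ] ℂ :=
  (ContinuousLinearMap.proj (R := ℂ) (φ := fun _ : Fin n => ℂ) a.2).comp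
    (ContinuousLinearMap.proj (R := ℂ) (φ := fun _ : Fin n => Fin n → ℂ) a.1)

theorem coord_apply {n : ℕ} (a : Fin n × Fin n) (x : Mat n) : coord a x = x a.1 a.2 := rfl

/-- The differential of the polynomial function `x ↦ evalAt x p`. -/
noncomputable def dEval {n : ℕ} (p : Poly n) (x : Mat n) : Mat n →L[ℂ] ℂ :=
  ∑ a : Fin n × Fin n, evalAt x (MvPolynomial.pderiv a p) • coord a

theorem dEval_apply {n : ℕ} (p : Poly n) (x v : Mat n) :
    dEval p x v = ∑ a : Fin n × Fin n, evalAt x (MvPolynomial.pderiv a p) * v a.1 a.2 := by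
  simp [dEval, coord_apply]

theorem hasFDerivAt_evalAt {n : ℕ} (p : Poly n) (x : Mat n) :
    HasFDerivAt (fun y : Mat n => evalAt y p) (dEval p x) x := by
  induction p using MvPolynomial.induction_on with
  | C c =>
    have h : dEval (MvPolynomial.C c) x = 0 := by
      ext v; simp [dEval_apply, evalAt]
    rw [h]
    simpa only [evalAt_C] using hasFDerivAt_const c x
  | add p q hp hq =>
    have h : dEval (p + q) x = dEval p x + dEval q x := by
      ext v; simp [dEval_apply, evalAt, add_mul, Finset.sum_add_distrib]
    rw [h]
    simp only [evalAt_add]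
    exact hp.add hq
  | mul_X p a hp =>
    have h : dEval (p * MvPolynomial.X a) x = evalAt x p • coord a + coord a x • dEval p x := by
      ext v
      simp only [dEval_apply, Derivation.leibniz, evalAt_add, smul_eq_mul, evalAt_mul, evalAt_X,
        add_mul, Finset.sum_add_distrib, _root_.add_apply, _root_.smul_apply, coord_apply,
        Finset.mul_sum, MvPolynomial.pderiv_X]
      congr 1
      · rw [Finset.sum_eq_single a]
        · simp [evalAt]
        · intro b _ hb
          simp [hb.symm, evalAt]
        · simp
      · exact Finset.sum_congr rfl fun b _ => by ring
    rw [h]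
    simp only [evalAt_mul, evalAt_X, ← coord_apply a]
    exact hp.mul (coord a).hasFDerivAt

/-- The value of `[p, q]` is the derivative of `q` along `ξ_p`. -/
theorem evalAt_poisson {n : ℕ} (p q : Poly n) (x : Mat n) :
    evalAt x (poisson p q) = dEval q x (ham p x) := by
  simp only [dEval_apply, ham, poisson, evalAt_sum, evalAt_mul, MvPolynomial.pderiv_X]
  rw [Finset.sum_comm]
  refine Finset.sum_congr rfl fun b _ => ?_
  rw [Finset.mul_sum]
  refine Finset.sum_congr rfl fun a _ => ?_
  rw [Finset.sum_eq_single b]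
  · simp [evalAt]; ring
  · intro c _ hc
    simp [hc.symm, evalAt]
  · simp

theorem poisson_antisymm {n : ℕ} (p q : Poly n) : poisson p q = -poisson q p := by
  rw [poisson, poisson, Finset.sum_comm, ← Finset.sum_neg_distrib]
  refine Finset.sum_congr rfl fun b _ => ?_
  rw [← Finset.sum_neg_distrib]
  refine Finset.sum_congr rfl fun a _ => ?_
  have h : coordBracket a b = -coordBracket b a := by
    simp only [coordBracket, neg_sub, eq_comm]
  rw [h]; ring

theorem analyticAt_evalAt {n : ℕ} (p : Poly n) (x : Mat n) :
    AnalyticAt ℂ (fun y : Mat n => evalAt y p) x :=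
  AnalyticOnNhd.eval_continuousLinearMap' (fun a : Fin n × Fin n => coord a) p x (Set.mem_univ _)

/-! ### Gradients of traces of powers of blocks -/

section Blocks

variable {R : Type*} [CommRing R]

/-- The `n × m` matrix of the inclusion of the first `m` coordinates. -/
def blockIncl (R : Type*) [CommRing R] (n m : ℕ) : Matrix (Fin n) (Fin m) R :=
  Matrix.of fun i j => if i.val = j.val then 1 else 0

/-- The diagonal projection onto the first `m` coordinates. -/
def blockProj (R : Type*) [CommRing R] (n m : ℕ) : Matrix (Fin n) (Fin n) R :=
  Matrix.diagonal fun i => if i.val < m then 1 else 0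

/-- The `j`-th power of the upper left `m × m` block of `A`, extended by zero to an `n × n`
matrix; for `j = 0` this is the projection onto the first `m` coordinates. -/
def blockPow {n : ℕ} (A : Matrix (Fin n) (Fin n) R) (m j : ℕ) : Matrix (Fin n) (Fin n) R :=
  (blockProj R n m * A * blockProj R n m) ^ j * blockProj R n m

theorem blockPow_zero {n : ℕ} (A : Matrix (Fin n) (Fin n) R) (m : ℕ) :
    blockPow A m 0 = blockProj R n m := by
  rw [blockPow, pow_zero, one_mul]

theorem blockPow_succ {n : ℕ} (A : Matrix (Fin n) (Fin n) R) (m j : ℕ) :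
    blockPow A m (j + 1) = blockProj R n m * A * blockProj R n m * blockPow A m j := by
  rw [blockPow, blockPow, pow_succ', mul_assoc]

theorem blockIncl_mul_transpose (n m : ℕ) :
    blockIncl R n m * (blockIncl R n m).transpose = blockProj R n m := by
  ext i j
  simp only [blockIncl, blockProj, Matrix.mul_apply, Matrix.transpose_apply, Matrix.of_apply,
    Matrix.diagonal_apply]
  by_cases hi : i.val < m
  · rw [Finset.sum_eq_single (⟨i.val, hi⟩ : Fin m)]
    · simp [hi, Fin.ext_iff, eq_comm]
    · intro b _ hb
      rw [if_neg (fun h' => hb (Fin.ext h'.symm)), zero_mul]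
    · simp
  · rw [Finset.sum_eq_zero]
    · simp [hi]
    · intro b _
      rw [if_neg (fun h' : i.val = b.val => hi (h' ▸ b.2)), zero_mul]

theorem transpose_mul_mul_blockIncl {n m : ℕ} (h : m ≤ n) (A : Matrix (Fin n) (Fin n) R) :
    (blockIncl R n m).transpose * A * blockIncl R n m =
      A.submatrix (Fin.castLE h) (Fin.castLE h) := by
  ext i j
  simp only [blockIncl, Matrix.mul_apply, Matrix.transpose_apply, Matrix.of_apply,
    Matrix.submatrix_apply]
  rw [Finset.sum_eq_single (Fin.castLE h j), Finset.sum_eq_single (Fin.castLE h i)]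
  · simp
  · intro b _ hb
    have hb' : ¬ b.val = i.val := fun h' => hb (Fin.ext h')
    rw [if_neg hb', zero_mul]
  · simp
  · intro b _ hb
    have hb' : ¬ b.val = j.val := fun h' => hb (Fin.ext h')
    rw [if_neg hb', mul_zero]
  · simp

theorem transpose_mul_blockIncl {n m : ℕ} (h : m ≤ n) :
    (blockIncl R n m).transpose * blockIncl R n m = 1 := by
  have := transpose_mul_mul_blockIncl (R := R) h 1
  rw [Matrix.mul_one] at this
  rw [this]
  exact Matrix.submatrix_one _ (Fin.castLE_injective h)

/-- `blockPow` is the power of the block, transported along the inclusion of coordinates. The two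
descriptions serve different purposes: blocks for traces and characteristic polynomials, `n × n`
matrices for commutation relations. -/
theorem blockIncl_mul_pow_mul_transpose {n m : ℕ} (h : m ≤ n) (A : Matrix (Fin n) (Fin n) R)
    (j : ℕ) :
    blockIncl R n m * A.submatrix (Fin.castLE h) (Fin.castLE h) ^ j *
      (blockIncl R n m).transpose = blockPow A m j := by
  induction j with
  | zero => rw [pow_zero, Matrix.mul_one, blockIncl_mul_transpose, blockPow_zero]
  | succ j ih =>
    rw [blockPow_succ, ← ih, pow_succ',
      ← transpose_mul_mul_blockIncl, ← blockIncl_mul_transpose]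
    have h1 := transpose_mul_blockIncl (R := R) h
    generalize blockIncl R n m = E at *
    generalize (E.transpose * A * E) ^ j = B
    simp only [Matrix.mul_assoc]
    rw [← Matrix.mul_assoc E.transpose E, h1, Matrix.one_mul]

theorem trace_blockPow {n m : ℕ} (h : m ≤ n) (A : Matrix (Fin n) (Fin n) R) (j : ℕ) :
    (blockPow A m j).trace = (A.submatrix (Fin.castLE h) (Fin.castLE h) ^ j).trace := by
  rw [← blockIncl_mul_pow_mul_transpose h, Matrix.trace_mul_comm, ← Matrix.mul_assoc,
    transpose_mul_blockIncl h, Matrix.one_mul]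

end Blocks

theorem map_derivation_mul {R ι : Type*} [CommRing R] [Algebra ℂ R] [Fintype ι]
    (D : Derivation ℂ R R) (A B : Matrix ι ι R) :
    (A * B).map D = A.map D * B + A * B.map D := by
  ext i j
  simp only [Matrix.map_apply, Matrix.mul_apply, map_sum, Derivation.leibniz, Matrix.add_apply,
    ← Finset.sum_add_distrib, smul_eq_mul]
  exact Finset.sum_congr rfl fun k _ => by ring

/-- The derivative of a trace of a power, with a commuting factor `B` inserted so that the induction
goes through. -/
theorem trace_mul_map_derivation_pow {R ι : Type*} [CommRing R] [Algebra ℂ R] [Fintype ι]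
    [DecidableEq ι] (D : Derivation ℂ R R) (A B : Matrix ι ι R) (hB : Commute A B) (j : ℕ) :
    (B * (A ^ (j + 1)).map D).trace = ((j + 1 : ℕ) : R) * (B * A ^ j * A.map D).trace := by
  induction j generalizing B with
  | zero => simp
  | succ j ih =>
    have h1 := ih (B * A) (hB.mul_right (Commute.refl A))
    rw [pow_succ', map_derivation_mul, mul_add, Matrix.trace_add, ← mul_assoc B A, h1]
    have h2 : (B * (A.map D * A ^ (j + 1))).trace = (B * A ^ (j + 1) * A.map D).trace := by
      rw [← mul_assoc, Matrix.trace_mul_comm, ← mul_assoc, (hB.pow_left (j + 1)).eq]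
    rw [h2, mul_assoc B A, ← pow_succ']
    push_cast; ring

theorem derivation_trace_pow {R ι : Type*} [CommRing R] [Algebra ℂ R] [Fintype ι]
    [DecidableEq ι] (D : Derivation ℂ R R) (A : Matrix ι ι R) (j : ℕ) :
    D (A ^ (j + 1)).trace = ((j + 1 : ℕ) : R) * (A ^ j * A.map D).trace := by
  have := trace_mul_map_derivation_pow D A 1 (Commute.one_right A) j
  rw [one_mul, one_mul] at this
  rw [← this]
  simp [Matrix.trace, map_sum]

theorem incl_mvPolynomialX {n m : ℕ} (h : m ≤ n) :
    (Matrix.mvPolynomialX (Fin m) (Fin m) ℂ).map (incl h) =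
      (Matrix.mvPolynomialX (Fin n) (Fin n) ℂ).submatrix (Fin.castLE h) (Fin.castLE h) := by
  ext i j
  simp [Matrix.mvPolynomialX, incl]

theorem incl_trace_pow {n m : ℕ} (h : m ≤ n) (j : ℕ) :
    incl h (Matrix.mvPolynomialX (Fin m) (Fin m) ℂ ^ j).trace =
      ((Matrix.mvPolynomialX (Fin n) (Fin n) ℂ).submatrix (Fin.castLE h) (Fin.castLE h)
        ^ j).trace := by
  rw [← incl_mvPolynomialX]
  have : ∀ A : Matrix (Fin m) (Fin m) (Poly m), incl h A.trace = (A.map (incl h)).trace := by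
    intro A; simp [Matrix.trace, map_sum]
  rw [this]
  congr 1
  exact map_pow (incl h).mapMatrix _ _

theorem map_evalAt_mvPolynomialX {n : ℕ} (x : Mat n) :
    (Matrix.mvPolynomialX (Fin n) (Fin n) ℂ).map (evalAt x) = Matrix.of x := by
  ext i j
  simp [Matrix.mvPolynomialX, evalAt_X]

theorem map_evalAt_mul {n : ℕ} {ι κ μ : Type*} [Fintype κ] (x : Mat n)
    (A : Matrix ι κ (Poly n)) (B : Matrix κ μ (Poly n)) :
    (A * B).map (evalAt x) = A.map (evalAt x) * B.map (evalAt x) := by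
  ext i j
  simp [Matrix.mul_apply, evalAt]

theorem map_evalAt_blockPow {n : ℕ} (x : Mat n) (A : Matrix (Fin n) (Fin n) (Poly n)) (m j : ℕ) :
    (blockPow A m j).map (evalAt x) = blockPow (A.map (evalAt x)) m j := by
  have hP : (blockProj (Poly n) n m).map (evalAt x) = blockProj ℂ n m := by
    ext i k
    simp only [blockProj, Matrix.map_apply, Matrix.diagonal_apply, evalAt]
    split_ifs <;> simp
  induction j with
  | zero => simp only [blockPow_zero, hP]
  | succ j ih =>
    simp only [blockPow_succ, map_evalAt_mul, hP, ih]

theorem pderiv_trace_block_pow {n m : ℕ} (h : m ≤ n) (a b : Fin n) (j : ℕ) :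
    MvPolynomial.pderiv (a, b) ((Matrix.mvPolynomialX (Fin n) (Fin n) ℂ).submatrix
      (Fin.castLE h) (Fin.castLE h) ^ (j + 1)).trace =
    ((j + 1 : ℕ) : Poly n) * blockPow (Matrix.mvPolynomialX (Fin n) (Fin n) ℂ) m j b a := by
  rw [derivation_trace_pow, ← blockIncl_mul_pow_mul_transpose h]
  congr 1
  have : ((Matrix.mvPolynomialX (Fin n) (Fin n) ℂ).submatrix (Fin.castLE h) (Fin.castLE h)).map
      (MvPolynomial.pderiv (a, b)) =
      (blockIncl (Poly n) n m).transpose * (Matrix.single a b 1 : Matrix _ _ (Poly n)) *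
        blockIncl (Poly n) n m := by
    rw [transpose_mul_mul_blockIncl h]
    ext i k : 2
    simp only [Matrix.mvPolynomialX, Matrix.map_apply, Matrix.submatrix_apply, Matrix.of_apply,
      MvPolynomial.pderiv_X, Matrix.single_apply, Pi.single_apply, Prod.mk.injEq, eq_comm]
  rw [this, ← Matrix.mul_assoc, Matrix.trace_mul_comm, ← Matrix.mul_assoc, ← Matrix.mul_assoc,
    Matrix.trace_mul_single]
  simp

/-- The gradient of `tr (x_m ^ (j + 1)) / (j + 1)` is `x_m ^ j`, extended by zero. -/
theorem grad_tracePoly {n : ℕ} (k m : ℕ) (h : m ≤ n) (hk : k ≤ m) (x : Mat n) :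
    grad (tracePoly k m h) x = blockPow (Matrix.of x) m (m - k) := by
  obtain ⟨j, rfl⟩ : ∃ j, m = k + j := ⟨m - k, by omega⟩
  have e1 : k + j + 1 - k = j + 1 := by omega
  have e2 : k + j - k = j := by omega
  ext b a
  rw [tracePoly, e1, e2, map_mul, incl_trace_pow]
  have hC : incl h (MvPolynomial.C (1 / ((j + 1 : ℕ) : ℂ))) =
      MvPolynomial.C (1 / ((j + 1 : ℕ) : ℂ)) := by simp [incl]
  rw [hC, grad, Matrix.of_apply, MvPolynomial.pderiv_C_mul, pderiv_trace_block_pow, evalAt_mul,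
    evalAt_C, evalAt_mul, ← map_evalAt_mvPolynomialX x, ← map_evalAt_blockPow, Matrix.map_apply]
  have h1 : evalAt x ((j + 1 : ℕ) : Poly n) = ((j + 1 : ℕ) : ℂ) := by simp [evalAt]
  have h2 : ((j + 1 : ℕ) : ℂ) ≠ 0 := by exact_mod_cast Nat.succ_ne_zero j
  rw [h1, ← mul_assoc, one_div, inv_mul_cancel₀ h2, one_mul]

theorem ham_tracePoly {n : ℕ} (k m : ℕ) (h : m ≤ n) (hk : k ≤ m) (x : Mat n) :
    Matrix.of (ham (tracePoly k m h) x) =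
      blockPow (Matrix.of x) m (m - k) * Matrix.of x -
        Matrix.of x * blockPow (Matrix.of x) m (m - k) := by
  rw [ham_eq_grad, grad_tracePoly k m h hk]

theorem evalAt_tracePoly {n : ℕ} (k m : ℕ) (h : m ≤ n) (x : Mat n) :
    evalAt x (tracePoly k m h) =
      1 / ((m + 1 - k : ℕ) : ℂ) * (blockPow (Matrix.of x) m (m + 1 - k)).trace := by
  rw [tracePoly, map_mul, incl_trace_pow, evalAt_mul, ← trace_blockPow,
    ← map_evalAt_mvPolynomialX x, ← map_evalAt_blockPow]
  congr 1
  · simp [incl, evalAt]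
  · simp [Matrix.trace, evalAt_sum]

theorem blockProj_self (R : Type*) [CommRing R] (n : ℕ) : blockProj R n n = 1 := by
  simp [blockProj]

/-- The traces of the powers of the full matrix are Casimir functions. -/
theorem ham_tracePoly_self {n : ℕ} (k : ℕ) (hk : k ≤ n) :
    ham (tracePoly k n (le_refl n)) = 0 := by
  funext x
  apply Matrix.of.injective
  rw [ham_tracePoly _ _ _ hk, blockPow, blockProj_self, one_mul, mul_one, mul_one,
    (Commute.pow_self (Matrix.of x) (n - k)).eq, sub_self]
  rfl

/-! ### Newton's identities for matrices -/

section Newton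

open Polynomial

variable {R : Type*} [CommRing R] {ι : Type*} [Fintype ι] [DecidableEq ι]

theorem derivative_det_eq_sum_updateCol (M : Matrix ι ι R[X]) :
    derivative M.det = ∑ i, (M.updateCol i fun k => derivative (M k i)).det := by
  simp only [Matrix.det_apply', derivative_sum]
  rw [Finset.sum_comm]
  refine Finset.sum_congr rfl fun σ _ => ?_
  rw [derivative_intCast_mul, derivative_prod_finset, Finset.mul_sum]
  refine Finset.sum_congr rfl fun i _ => ?_
  rw [← Finset.prod_erase_mul _ _ (Finset.mem_univ i), Matrix.updateCol_self]
  congr 2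
  refine Finset.prod_congr rfl fun k hk => ?_
  rw [Matrix.updateCol_ne (Finset.ne_of_mem_erase hk)]

/-- Jacobi's formula for the derivative of the characteristic polynomial. -/
theorem derivative_charpoly_eq_trace_adjugate (A : Matrix ι ι R) :
    derivative A.charpoly = (Matrix.adjugate A.charmatrix).trace := by
  rw [Matrix.charpoly, derivative_det_eq_sum_updateCol, Matrix.trace]
  refine Finset.sum_congr rfl fun i _ => ?_
  rw [Matrix.diag_apply, ← Matrix.transpose_apply (Matrix.adjugate _), Matrix.adjugate_transpose,
    Matrix.adjugate_apply, Matrix.updateRow_transpose, Matrix.det_transpose]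
  congr 2
  funext k
  by_cases h : k = i
  · subst h; simp [Matrix.charmatrix_apply_eq]
  · simp [h]

/-- The coefficient of `λ ^ i` in the adjugate of `λ - A`. -/
noncomputable def adjCoeff (A : Matrix ι ι R) (i : ℕ) : Matrix ι ι R :=
  (Matrix.adjugate A.charmatrix).map fun p => p.coeff i

theorem charmatrix_mul_coeff (A : Matrix ι ι R) (k : ℕ) :
    (A.charmatrix * Matrix.adjugate A.charmatrix).map (fun p => p.coeff k) =
      A.charpoly.coeff k • 1 := by
  rw [Matrix.mul_adjugate, ← Matrix.charpoly]
  ext i j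
  by_cases h : i = j <;> simp [h]

/-- Comparison of the coefficients of `λ ^ (i + 1)` in `(λ - A) * adj (λ - A) = charpoly A`. -/
theorem adjCoeff_eq (A : Matrix ι ι R) (i : ℕ) :
    adjCoeff A i = A * adjCoeff A (i + 1) + A.charpoly.coeff (i + 1) • 1 := by
  rw [← charmatrix_mul_coeff]
  ext a b
  simp only [Matrix.charmatrix, adjCoeff, Matrix.sub_mul, Matrix.scalar_apply, Matrix.add_apply,
    Matrix.map_apply, Matrix.sub_apply, Matrix.diagonal_mul, coeff_sub, coeff_X_mul]
  simp [Matrix.mul_apply, finsetSum_coeff]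

theorem mul_adjCoeff_zero (A : Matrix ι ι R) :
    A * adjCoeff A 0 = -(A.charpoly.coeff 0 • (1 : Matrix ι ι R)) := by
  rw [← charmatrix_mul_coeff]
  ext a b
  simp only [Matrix.charmatrix, adjCoeff, Matrix.sub_mul, Matrix.scalar_apply, Matrix.neg_apply,
    Matrix.map_apply, Matrix.sub_apply, Matrix.diagonal_mul, coeff_sub, coeff_X_mul_zero]
  simp [Matrix.mul_apply, finsetSum_coeff]

theorem adjCoeff_eq_zero (A : Matrix ι ι R) {i : ℕ} (hi : Fintype.card ι ≤ i) :
    adjCoeff A i = 0 := by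
  nontriviality R
  -- The coefficients vanish for large indices, and the recursion propagates this downwards.
  obtain ⟨N, hN⟩ : ∃ N, ∀ k, N ≤ k → adjCoeff A k = 0 := by
    refine ⟨(∑ a, ∑ b, (Matrix.adjugate A.charmatrix a b).natDegree) + 1, fun k hk => ?_⟩
    ext a b
    refine coeff_eq_zero_of_natDegree_lt (lt_of_lt_of_le (Nat.lt_succ_of_le ?_) hk)
    exact (Finset.single_le_sum (f := fun b => (Matrix.adjugate A.charmatrix a b).natDegree)
      (fun _ _ => Nat.zero_le _) (Finset.mem_univ b)).trans
      (Finset.single_le_sum (f := fun a => ∑ b, (Matrix.adjugate A.charmatrix a b).natDegree)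
      (fun _ _ => Nat.zero_le _) (Finset.mem_univ a))
  have key : ∀ d k, Fintype.card ι ≤ k → N ≤ k + d → adjCoeff A k = 0 := by
    intro d
    induction d with
    | zero => intro k _ h; exact hN k h
    | succ d ih =>
      intro k hk h
      rw [adjCoeff_eq, ih (k + 1) (by omega) (by omega), Matrix.mul_zero, zero_add,
        coeff_eq_zero_of_natDegree_lt, zero_smul]
      rw [Matrix.charpoly_natDegree_eq_dim]; omega
  exact key N i hi (by omega)

/-- Newton's identities, stated through the coefficients of the adjugate: combine
`tr adj (λ - A) = charpoly' (λ)` with the recursion for these coefficients. -/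
theorem trace_mul_adjCoeff (A : Matrix ι ι R) (i : ℕ) :
    (A * adjCoeff A i).trace = ((i : R) - Fintype.card ι) * A.charpoly.coeff i := by
  cases i with
  | zero => rw [mul_adjCoeff_zero]; simp [mul_comm]
  | succ i =>
    have h1 : (adjCoeff A i).trace = A.charpoly.coeff (i + 1) * (i + 1) := by
      rw [← coeff_derivative, derivative_charpoly_eq_trace_adjugate]
      simp [adjCoeff, Matrix.trace, finsetSum_coeff]
    rw [adjCoeff_eq, Matrix.trace_add, Matrix.trace_smul, Matrix.trace_one, smul_eq_mul] at h1
    push_cast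
    linear_combination h1

/-- Newton's identities: over a `ℚ`-algebra the coefficients of the characteristic polynomial are
polynomials in the traces of the powers. -/
theorem charpoly_coeff_mem_of_trace_pow_mem [Algebra ℂ R] (S : Subalgebra ℂ R) (A : Matrix ι ι R)
    (hS : ∀ k, 1 ≤ k → k ≤ Fintype.card ι → (A ^ k).trace ∈ S) (i : ℕ) :
    A.charpoly.coeff i ∈ S := by
  nontriviality R
  -- The bound `k ≤ i + 1` guarantees that only traces of powers up to the size of `A` occur.
  have hQ : ∀ d i, i + d = Fintype.card ι → (∀ l, i < l → A.charpoly.coeff l ∈ S) →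
      ∀ k, 1 ≤ k → k ≤ i + 1 → (A ^ k * adjCoeff A i).trace ∈ S := by
    intro d
    induction d with
    | zero =>
      intro i hi _ k _ _
      rw [adjCoeff_eq_zero A (by omega), Matrix.mul_zero, Matrix.trace_zero]
      exact S.zero_mem
    | succ d ih =>
      intro i hi hl k hk hk'
      rw [adjCoeff_eq, Matrix.mul_add, Matrix.trace_add, ← Matrix.mul_assoc, ← pow_succ,
        mul_smul_comm, Matrix.mul_one, Matrix.trace_smul]
      refine S.add_mem (ih (i + 1) (by omega) (fun l h => hl l (by omega)) _ (by omega) (by omega))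
        (S.mul_mem (hl _ (by omega)) (hS k hk (by omega)))
  -- Descending induction on the index of the coefficient.
  have hP : ∀ d i, Fintype.card ι ≤ i + d → A.charpoly.coeff i ∈ S := by
    intro d
    induction d with
    | zero =>
      intro i hi
      rcases hi.lt_or_eq with h | h
      · rw [coeff_eq_zero_of_natDegree_lt (by rw [Matrix.charpoly_natDegree_eq_dim]; omega)]
        exact S.zero_mem
      · have h1 := A.charpoly_monic.coeff_natDegree
        rw [Matrix.charpoly_natDegree_eq_dim, h, add_zero] at h1
        rw [h1]; exact S.one_mem
    | succ d ih =>
      intro i hi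
      rcases Nat.lt_or_ge i (Fintype.card ι) with h | h
      · have h1 := hQ (Fintype.card ι - i) i (by omega) (fun l hl => ih l (by omega)) 1 le_rfl
          (by omega)
        rw [pow_one, trace_mul_adjCoeff] at h1
        have h2 : ((i : ℂ) - Fintype.card ι) ≠ 0 := by
          rw [sub_ne_zero]; exact_mod_cast h.ne
        have h3 := S.smul_mem h1 ((i : ℂ) - Fintype.card ι)⁻¹
        rwa [show ((i : R) - Fintype.card ι) = algebraMap ℂ R ((i : ℂ) - Fintype.card ι) by simp,
          ← Algebra.smul_def, smul_smul, inv_mul_cancel₀ h2, one_smul] at h3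
      · exact ih i (by omega)
  exact hP _ i (Nat.le_add_left _ _)

end Newton

/-! ### Conjugation invariant polynomials -/

section Invariants

variable {R : Type*} [CommRing R] {m : ℕ}

/-- The companion matrix of the characteristic polynomial of `A`. -/
noncomputable def companionOf (A : Matrix (Fin m) (Fin m) R) : Matrix (Fin m) (Fin m) R :=
  Matrix.of fun i j =>
    if j.val + 1 = m then -A.charpoly.coeff i else if i.val = j.val + 1 then 1 else 0

theorem map_companionOf {S : Type*} [CommRing S] (f : R →+* S) (A : Matrix (Fin m) (Fin m) R) :
    (companionOf A).map f = companionOf (A.map f) := by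
  ext i j
  simp only [companionOf, Matrix.map_apply, Matrix.of_apply, Matrix.charpoly_map,
    Polynomial.coeff_map]
  split_ifs <;> simp

variable [NeZero m]

/-- The matrix with columns `e, A e, A² e, …`, where `e` is the first basis vector. -/
def krylov (A : Matrix (Fin m) (Fin m) R) : Matrix (Fin m) (Fin m) R :=
  Matrix.of fun i j => (A ^ j.val) i 0

/-- Multiplication by `A` shifts the columns `A ^ j e`; the last column is handled by
Cayley-Hamilton. -/
theorem mul_krylov (A : Matrix (Fin m) (Fin m) R) :
    A * krylov A = krylov A * companionOf A := by
  nontriviality R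
  ext i j
  have h1 : (A * krylov A) i j = (A ^ (j.val + 1)) i 0 := by
    rw [pow_succ', Matrix.mul_apply, Matrix.mul_apply]; rfl
  rw [h1, Matrix.mul_apply]
  by_cases hj : j.val + 1 = m
  · have h2 := A.aeval_self_charpoly
    rw [Polynomial.aeval_eq_sum_range, Matrix.charpoly_natDegree_eq_dim, Fintype.card_fin,
      Finset.sum_range_succ, ← Fin.sum_univ_eq_sum_range
        (fun k => A.charpoly.coeff k • A ^ k) m] at h2
    have h3 := A.charpoly_monic.coeff_natDegree
    rw [Matrix.charpoly_natDegree_eq_dim, Fintype.card_fin] at h3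
    rw [h3, one_smul] at h2
    have h4 := congrFun (congrFun h2 i) 0
    rw [Matrix.add_apply, Matrix.sum_apply, Matrix.zero_apply] at h4
    rw [hj, eq_neg_of_add_eq_zero_right h4, ← Finset.sum_neg_distrib]
    refine Finset.sum_congr rfl fun k _ => ?_
    simp [krylov, companionOf, hj, mul_comm]
  · rw [Finset.sum_eq_single (⟨j.val + 1, by omega⟩ : Fin m)]
    · simp [krylov, companionOf, hj]
    · intro k _ hk
      have : ¬ k.val = j.val + 1 := fun h => hk (Fin.ext h)
      simp [companionOf, hj, this]
    · simp

theorem map_krylov {S : Type*} [CommRing S] (f : R →+* S) (A : Matrix (Fin m) (Fin m) R) :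
    (krylov A).map f = krylov (A.map f) := by
  ext i j
  have := congrFun (congrFun (map_pow f.mapMatrix A j.val) i) 0
  simpa [krylov] using this

end Invariants

/-- The nilpotent matrix with ones below the diagonal. -/
def shift (n : ℕ) : Mat n := fun i j => if i.val = j.val + 1 then 1 else 0

theorem krylov_shift (m : ℕ) [NeZero m] : krylov (Matrix.of (shift m)) = 1 := by
  have key : ∀ (k : ℕ) (i : Fin m),
      ((Matrix.of (shift m)) ^ k) i 0 = if i.val = k then 1 else 0 := by
    intro k
    induction k with
    | zero => intro i; simp only [pow_zero, Matrix.one_apply, Fin.ext_iff, Fin.val_zero]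
    | succ k ih =>
      intro i
      rw [pow_succ', Matrix.mul_apply]
      simp only [ih, Matrix.of_apply, shift, mul_ite, mul_one, mul_zero]
      by_cases hi : i.val = k + 1
      · rw [if_pos hi, Finset.sum_eq_single (⟨k, by omega⟩ : Fin m)]
        · simp [hi]
        · intro l _ hl
          have : ¬ l.val = k := fun h => hl (Fin.ext h)
          simp [this]
        · simp
      · rw [if_neg hi]
        refine Finset.sum_eq_zero fun l _ => ?_
        split_ifs <;> first | rfl | omega
  ext i j
  rw [krylov, Matrix.of_apply, key, Matrix.one_apply]
  simp [Fin.ext_iff]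

/-- An invariant polynomial `q` satisfies `q (x) = q (companion matrix of x)`: this holds whenever
the first basis vector is cyclic for `x`, since `x` and its companion matrix are then conjugate,
and cyclicity is the non-vanishing of a nonzero polynomial. -/
theorem IsAdInvariant.eq_aeval_companionOf {m : ℕ} [NeZero m] {q : Poly m} (hq : IsAdInvariant q) :
    q = MvPolynomial.aeval (fun ij : Fin m × Fin m =>
      companionOf (Matrix.mvPolynomialX (Fin m) (Fin m) ℂ) ij.1 ij.2) q := by
  set q' := MvPolynomial.aeval (fun ij : Fin m × Fin m =>
      companionOf (Matrix.mvPolynomialX (Fin m) (Fin m) ℂ) ij.1 ij.2) q with hq'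
  let ev (x : Mat m) : Poly m →+* ℂ := MvPolynomial.eval fun ij : Fin m × Fin m => x ij.1 ij.2
  have hX : ∀ x : Mat m, (Matrix.mvPolynomialX (Fin m) (Fin m) ℂ).map (ev x) = Matrix.of x :=
    map_evalAt_mvPolynomialX
  have hev : ∀ x : Mat m,
      evalAt x q' = evalAt (Matrix.of.symm (companionOf (Matrix.of x))) q := by
    intro x
    rw [← hX x, ← map_companionOf, hq']
    change ev x _ = _
    rw [MvPolynomial.aeval_def, MvPolynomial.algebraMap_eq, MvPolynomial.hom_eval₂]
    have : (ev x).comp MvPolynomial.C = RingHom.id ℂ := by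
      ext c; simp [ev]
    rw [this]
    rfl
  have hD : ∀ x : Mat m, evalAt x (krylov (Matrix.mvPolynomialX (Fin m) (Fin m) ℂ)).det =
      (krylov (Matrix.of x)).det := by
    intro x
    rw [← hX x, ← map_krylov]
    exact RingHom.map_det (ev x) _
  -- The first basis vector is cyclic for the shift.
  have h0 : (krylov (Matrix.mvPolynomialX (Fin m) (Fin m) ℂ)).det ≠ 0 := by
    intro h
    have := hD (shift m)
    rw [h, krylov_shift, Matrix.det_one] at this
    simp [evalAt] at this
  refine mul_left_cancel₀ h0 (eq_of_evalAt fun x => ?_)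
  rw [evalAt_mul, evalAt_mul, hD, hev]
  by_cases hx : (krylov (Matrix.of x)).det = 0
  · rw [hx, zero_mul, zero_mul]
  · congr 1
    let g := Matrix.GeneralLinearGroup.mkOfDetNeZero (krylov (Matrix.of x)) hx
    rw [← hq g (Matrix.of.symm (companionOf _))]
    congr 1
    apply Matrix.of.injective
    rw [Ad, Equiv.apply_symm_apply, Equiv.apply_symm_apply]
    have hg : (g : Matrix (Fin m) (Fin m) ℂ) = krylov (Matrix.of x) := rfl
    have : krylov (Matrix.of x) * ((g⁻¹ : GL (Fin m) ℂ) : Matrix (Fin m) (Fin m) ℂ) = 1 :=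
      Units.mul_inv g
    rw [hg, ← mul_krylov, mul_assoc, this, mul_one]

/-! ### Generators of `J(n)` -/

theorem evalAt_incl {n m : ℕ} (h : m ≤ n) (x : Mat n) (p : Poly m) :
    evalAt x (incl h p) = evalAt (Matrix.of.symm (cutoff h x)) p := by
  simp only [evalAt, incl, MvPolynomial.eval_rename]
  rfl

theorem evalAt_charpoly_coeff {m : ℕ} (x : Mat m) (i : ℕ) :
    evalAt x ((Matrix.mvPolynomialX (Fin m) (Fin m) ℂ).charpoly.coeff i) =
      (Matrix.of x).charpoly.coeff i := by
  rw [← map_evalAt_mvPolynomialX x]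
  change MvPolynomial.eval _ _ = (Matrix.charpoly
    ((Matrix.mvPolynomialX (Fin m) (Fin m) ℂ).map (MvPolynomial.eval _))).coeff i
  rw [Matrix.charpoly_map, Polynomial.coeff_map]

theorem incl_charpoly_coeff_mem_J {n m : ℕ} (hm : 1 ≤ m) (h : m ≤ n) (i : ℕ) :
    incl h ((Matrix.mvPolynomialX (Fin m) (Fin m) ℂ).charpoly.coeff i) ∈ J n := by
  have hinv : IsAdInvariant ((Matrix.mvPolynomialX (Fin m) (Fin m) ℂ).charpoly.coeff i) := by
    intro g x
    rw [evalAt_charpoly_coeff, evalAt_charpoly_coeff, Ad, Equiv.apply_symm_apply,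
      Matrix.coe_units_inv,
      Matrix.charpoly_units_conj]
  exact Algebra.subset_adjoin ⟨m, hm, h, _, hinv, rfl⟩

theorem evalAt_trace_pow {m : ℕ} (x : Mat m) (k : ℕ) :
    evalAt x (Matrix.mvPolynomialX (Fin m) (Fin m) ℂ ^ k).trace = (Matrix.of x ^ k).trace := by
  rw [← map_evalAt_mvPolynomialX x]
  have := map_pow (MvPolynomial.eval fun ij : Fin m × Fin m => x ij.1 ij.2).mapMatrix
    (Matrix.mvPolynomialX (Fin m) (Fin m) ℂ) k
  change _ = (((MvPolynomial.eval fun ij : Fin m × Fin m => x ij.1 ij.2).mapMatrix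
    (Matrix.mvPolynomialX (Fin m) (Fin m) ℂ)) ^ k).trace
  rw [← this]
  simp [Matrix.trace, evalAt]

theorem tracePoly_mem_J {n : ℕ} (k m : ℕ) (hm : 1 ≤ m) (h : m ≤ n) : tracePoly k m h ∈ J n := by
  refine Algebra.subset_adjoin ⟨m, hm, h, _, fun g x => ?_, rfl⟩
  rw [evalAt_mul, evalAt_mul, evalAt_C, evalAt_C, evalAt_trace_pow, evalAt_trace_pow, Ad,
    Equiv.apply_symm_apply]
  congr 1
  rw [Units.conj_pow, Matrix.trace_units_conj]

/-- `J(n)` is generated by the functions `f_(k,m)`. -/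
theorem J_le_adjoin_tracePoly (n : ℕ) :
    J n ≤ Algebra.adjoin ℂ {p : Poly n | ∃ (k m : ℕ) (h : m ≤ n), 1 ≤ k ∧ k ≤ m ∧
      p = tracePoly k m h} := by
  set T := Algebra.adjoin ℂ {p : Poly n | ∃ (k m : ℕ) (h : m ≤ n), 1 ≤ k ∧ k ≤ m ∧
      p = tracePoly k m h} with hT
  refine Algebra.adjoin_le ?_
  rintro p ⟨m, hm, h, q, hq, rfl⟩
  have : NeZero m := ⟨by omega⟩
  have htr : ∀ k, 1 ≤ k → k ≤ Fintype.card (Fin m) →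
      (Matrix.mvPolynomialX (Fin m) (Fin m) ℂ ^ k).trace ∈ T.comap (incl h) := by
    intro k hk hk'
    rw [Fintype.card_fin] at hk'
    rw [Subalgebra.mem_comap]
    have h1 : tracePoly (m + 1 - k) m h ∈ T :=
      Algebra.subset_adjoin ⟨m + 1 - k, m, h, by omega, by omega, rfl⟩
    have h2 := T.smul_mem h1 (k : ℂ)
    have h3 : (k : ℂ) ≠ 0 := by exact_mod_cast (by omega : k ≠ 0)
    rw [tracePoly, show m + 1 - (m + 1 - k) = k by omega, ← MvPolynomial.smul_eq_C_mul,
      map_smul, smul_smul, mul_one_div_cancel h3, one_smul] at h2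
    exact h2
  have hco := charpoly_coeff_mem_of_trace_pow_mem (T.comap (incl h)) _ htr
  have : q ∈ T.comap (incl h) := by
    rw [hq.eq_aeval_companionOf, MvPolynomial.aeval_eq_eval₂Hom]
    rw [MvPolynomial.coe_eval₂Hom]
    refine MvPolynomial.eval₂_mem (s := T.comap (incl h)) (fun c _ => ?_) (fun ij => ?_)
    · exact (T.comap (incl h)).algebraMap_mem _
    · simp only [companionOf, Matrix.of_apply]
      split_ifs
      · exact neg_mem (hco _)
      · exact one_mem _
      · exact zero_mem _
  exact this

/-! ### The commuting flows -/

section BlockAlgebra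

variable {R : Type*} [CommRing R] {n : ℕ}

theorem blockProj_mul_of_le {l m : ℕ} (h : l ≤ m) :
    blockProj R n l * blockProj R n m = blockProj R n l := by
  rw [blockProj, blockProj, Matrix.diagonal_mul_diagonal]
  congr 1; funext i
  split_ifs <;> first | omega | simp

theorem blockProj_mul_of_ge {l m : ℕ} (h : l ≤ m) :
    blockProj R n m * blockProj R n l = blockProj R n l := by
  rw [blockProj, blockProj, Matrix.diagonal_mul_diagonal]
  congr 1; funext i
  split_ifs <;> first | omega | simp

theorem blockPow_commute_blockProj {m l : ℕ} (h : m ≤ l) (A : Matrix (Fin n) (Fin n) R) (j : ℕ) :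
    Commute (blockPow A m j) (blockProj R n l) := by
  have h1 : blockPow A m j * blockProj R n l = blockPow A m j := by
    rw [blockPow, mul_assoc, blockProj_mul_of_le h]
  have h2 : blockProj R n l * blockPow A m j = blockPow A m j := by
    cases j with
    | zero => rw [blockPow_zero, blockProj_mul_of_ge h]
    | succ j => rw [blockPow_succ]; simp only [← mul_assoc, blockProj_mul_of_ge h]
  rw [Commute, SemiconjBy, h1, h2]

theorem blockPow_commute_block (A : Matrix (Fin n) (Fin n) R) (m j : ℕ) :
    Commute (blockPow A m j) (blockProj R n m * A * blockProj R n m) := by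
  have h : Commute (blockProj R n m) (blockProj R n m * A * blockProj R n m) := by
    have hP := blockProj_mul_of_le (R := R) (n := n) (le_refl m)
    rw [Commute, SemiconjBy, mul_assoc _ (blockProj R n m), hP, ← mul_assoc, ← mul_assoc, hP]
  exact ((Commute.refl _).pow_left j).mul_left h

theorem blockPow_conj {A g g' : Matrix (Fin n) (Fin n) R} {l : ℕ} (hg : g * g' = 1)
    (hg' : g' * g = 1) (hc : Commute g (blockProj R n l)) (hc' : Commute g' (blockProj R n l))
    (j : ℕ) : blockPow (g * A * g') l j = g * blockPow A l j * g' := by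
  induction j with
  | zero => rw [blockPow_zero, blockPow_zero, hc.eq, mul_assoc, hg, mul_one]
  | succ j ih =>
    rw [blockPow_succ, blockPow_succ, ih]
    have h1 : blockProj R n l * (g * A * g') * blockProj R n l =
        g * (blockProj R n l * A * blockProj R n l) * g' := by
      simp only [mul_assoc]
      rw [hc'.eq, ← mul_assoc, ← hc.eq]
      simp only [mul_assoc]
    rw [h1]
    simp only [mul_assoc]
    rw [← mul_assoc g' g, hg', one_mul]

theorem blockPow_congr {A B : Matrix (Fin n) (Fin n) R} {l m : ℕ} (hl : l ≤ m)
    (h : blockProj R n m * A * blockProj R n m = blockProj R n m * B * blockProj R n m) (j : ℕ) :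
    blockPow A l j = blockPow B l j := by
  have key : ∀ C : Matrix (Fin n) (Fin n) R, blockProj R n l * C * blockProj R n l =
      blockProj R n l * (blockProj R n m * C * blockProj R n m) * blockProj R n l := by
    intro C
    simp only [mul_assoc, blockProj_mul_of_ge hl]
    simp only [← mul_assoc, blockProj_mul_of_le hl]
  rw [blockPow, blockPow, key A, key B, h]

end BlockAlgebra

section Flow

variable {n : ℕ}

/-- `exp B` as an invertible matrix. -/
noncomputable def expUnit (B : Matrix (Fin n) (Fin n) ℂ) : (Matrix (Fin n) (Fin n) ℂ)ˣ where
  val := NormedSpace.exp B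
  inv := NormedSpace.exp (-B)
  val_inv := by
    rw [← Matrix.exp_add_of_commute _ _ (Commute.neg_right (Commute.refl B)), add_neg_cancel,
      NormedSpace.exp_zero]
  inv_val := by
    rw [← Matrix.exp_add_of_commute _ _ (Commute.neg_left (Commute.refl B)), neg_add_cancel,
      NormedSpace.exp_zero]

theorem commute_expUnit {B C : Matrix (Fin n) (Fin n) ℂ} (h : Commute B C) :
    Commute (expUnit B : Matrix (Fin n) (Fin n) ℂ) C := by
  open scoped Matrix.Norms.Operator in exact h.exp_left

theorem commute_expUnit_inv {B C : Matrix (Fin n) (Fin n) ℂ} (h : Commute B C) :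
    Commute ((expUnit B)⁻¹ : (Matrix (Fin n) (Fin n) ℂ)ˣ).val C := by
  open scoped Matrix.Norms.Operator in exact h.neg_left.exp_left

theorem expUnit_add {B C : Matrix (Fin n) (Fin n) ℂ} (h : Commute B C) :
    expUnit (B + C) = expUnit B * expUnit C :=
  Units.ext (Matrix.exp_add_of_commute _ _ h)

theorem expUnit_zero : expUnit (0 : Matrix (Fin n) (Fin n) ℂ) = 1 :=
  Units.ext NormedSpace.exp_zero

theorem expUnit_conj (u : (Matrix (Fin n) (Fin n) ℂ)ˣ) (B : Matrix (Fin n) (Fin n) ℂ) :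
    expUnit (u.val * B * (u⁻¹).val) = u * expUnit B * u⁻¹ := by
  refine Units.ext ?_
  open scoped Matrix.Norms.Operator in exact NormedSpace.exp_units_conj u B

/-- The flow of the field `ξ_{f_(m-j,m)}`: conjugation by `exp (z x_m ^ j)`. -/
noncomputable def flow (m j : ℕ) (z : ℂ) (x : Mat n) : Mat n :=
  Ad (expUnit (z • blockPow (Matrix.of x) m j)) x

theorem of_Ad (g : GL (Fin n) ℂ) (x : Mat n) :
    Matrix.of (Ad g x) = g.val * Matrix.of x * (g⁻¹).val := rfl

theorem Ad_mul (g h : GL (Fin n) ℂ) (x : Mat n) : Ad (g * h) x = Ad g (Ad h x) := by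
  apply Matrix.of.injective
  simp only [of_Ad, mul_inv_rev, Units.val_mul, mul_assoc]

theorem Ad_one (x : Mat n) : Ad 1 x = x := by
  apply Matrix.of.injective
  simp [of_Ad]

/-- The flow conjugates by a matrix commuting with `x_m`, so the blocks of size `l ≤ m` do not
move. -/
theorem blockPow_flow_of_le {l m : ℕ} (h : l ≤ m) (i j : ℕ) (z : ℂ) (x : Mat n) :
    blockPow (Matrix.of (flow m j z x)) l i = blockPow (Matrix.of x) l i := by
  refine blockPow_congr h ?_ i
  rw [flow, of_Ad]
  set A := Matrix.of x
  have hP := (blockPow_commute_blockProj (le_refl m) A j).smul_left z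
  have hA := (blockPow_commute_block A m j).smul_left z
  have h1 := commute_expUnit hP
  have h2 := commute_expUnit_inv hP
  have h3 := commute_expUnit hA
  have h4 := (expUnit (z • blockPow A m j)).mul_inv
  generalize (expUnit (z • blockPow A m j)).val = g at *
  generalize ((expUnit (z • blockPow A m j))⁻¹).val = g' at *
  have h5 : blockProj ℂ n m * (g * A * g') * blockProj ℂ n m =
      g * (blockProj ℂ n m * A * blockProj ℂ n m) * g' := by
    simp only [mul_assoc]
    rw [h2.eq, ← mul_assoc, ← h1.eq]
    simp only [mul_assoc]
  rw [h5, h3.eq, mul_assoc, h4, mul_one]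

/-- The flow conjugates by a matrix in the image of `Gl(m)`, so the blocks of size `l ≥ m` are
conjugated by the same matrix. -/
theorem blockPow_flow_of_ge {l m : ℕ} (h : m ≤ l) (i j : ℕ) (z : ℂ) (x : Mat n) :
    blockPow (Matrix.of (flow m j z x)) l i =
      (expUnit (z • blockPow (Matrix.of x) m j)).val * blockPow (Matrix.of x) l i *
        ((expUnit (z • blockPow (Matrix.of x) m j))⁻¹).val := by
  rw [flow, of_Ad]
  have hP := (blockPow_commute_blockProj h (Matrix.of x) j).smul_left z
  exact blockPow_conj (Units.mul_inv _) (Units.inv_mul _) (commute_expUnit hP)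
    (commute_expUnit_inv hP) i

theorem flow_zero (m j : ℕ) (x : Mat n) : flow m j 0 x = x := by
  rw [flow, zero_smul, expUnit_zero, Ad_one]

theorem flow_add (m j : ℕ) (z w : ℂ) (x : Mat n) :
    flow m j (z + w) x = flow m j z (flow m j w x) := by
  conv_rhs => rw [flow, blockPow_flow_of_le le_rfl, flow, ← Ad_mul]
  rw [flow, add_smul, expUnit_add (((Commute.refl _).smul_left z).smul_right w)]

/-- The flows commute: for `m ≤ l` the flow of level `l` fixes `x_m`, while that of level `m`
conjugates `x_l`, and with it the generator of the flow of level `l`. -/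
theorem flow_comm (m j l i : ℕ) (z w : ℂ) (x : Mat n) :
    flow m j z (flow l i w x) = flow l i w (flow m j z x) := by
  wlog h : m ≤ l generalizing m j l i z w
  · exact (this l i m j w z (by omega)).symm
  conv_lhs => rw [flow, blockPow_flow_of_le h]
  conv_rhs => rw [flow, blockPow_flow_of_ge h, ← smul_mul_assoc, ← mul_smul_comm, expUnit_conj]
  rw [flow, flow, ← Ad_mul, ← Ad_mul, inv_mul_cancel_right]

theorem evalAt_tracePoly_flow (k m : ℕ) (hm : m ≤ n) (l j : ℕ) (z : ℂ) (x : Mat n) :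
    evalAt (flow l j z x) (tracePoly k m hm) = evalAt x (tracePoly k m hm) := by
  rw [evalAt_tracePoly, evalAt_tracePoly]
  rcases le_total m l with h | h
  · rw [blockPow_flow_of_le h]
  · rw [blockPow_flow_of_ge h, Matrix.trace_units_conj]

/-- The functions in `J(n)` are first integrals of the flows. -/
theorem evalAt_flow {p : Poly n} (hp : p ∈ J n) (l j : ℕ) (z : ℂ) (x : Mat n) :
    evalAt (flow l j z x) p = evalAt x p := by
  have h := J_le_adjoin_tracePoly n hp
  clear hp
  induction h using Algebra.adjoin_induction with
  | mem p hp =>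
    obtain ⟨k, m, hm, _, _, rfl⟩ := hp
    exact evalAt_tracePoly_flow k m hm l j z x
  | algebraMap r => rw [MvPolynomial.algebraMap_eq, evalAt_C, evalAt_C]
  | add p q _ _ hp hq => rw [evalAt_add, evalAt_add, hp, hq]
  | mul p q _ _ hp hq => rw [evalAt_mul, evalAt_mul, hp, hq]

open scoped Matrix.Norms.Operator

/-- The identification of `M(n)` with the algebra of matrices under the operator norm. The norm
serves only to make the exponential analytic; the topology is that of the entries. -/
noncomputable def toMatrixL (n : ℕ) : Mat n →L[ℂ] Matrix (Fin n) (Fin n) ℂ :=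
  LinearMap.toContinuousLinearMap (Matrix.ofLinearEquiv ℂ : (Mat n) ≃ₗ[ℂ] _).toLinearMap

/-- The inverse of `toMatrixL`. -/
noncomputable def ofMatrixL (n : ℕ) : Matrix (Fin n) (Fin n) ℂ →L[ℂ] Mat n :=
  LinearMap.toContinuousLinearMap (Matrix.ofLinearEquiv ℂ : (Mat n) ≃ₗ[ℂ] _).symm.toLinearMap

theorem flow_eq (m j : ℕ) (z : ℂ) (x : Mat n) :
    flow m j z x = ofMatrixL n (NormedSpace.exp (z • blockPow (toMatrixL n x) m j) *
      toMatrixL n x * NormedSpace.exp (-(z • blockPow (toMatrixL n x) m j))) := rfl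

theorem analyticAt_flow (m j : ℕ) (q : ℂ × Mat n) :
    AnalyticAt ℂ (fun q : ℂ × Mat n => flow m j q.1 q.2) q := by
  simp only [flow_eq]
  have hx : AnalyticAt ℂ (fun q : ℂ × Mat n => toMatrixL n q.2) q :=
    ((toMatrixL n).analyticAt _).comp analyticAt_snd
  have hG : AnalyticAt ℂ (fun q : ℂ × Mat n => q.1 • blockPow (toMatrixL n q.2) m j) q :=
    analyticAt_fst.smul ((((analyticAt_const.mul hx).mul analyticAt_const).pow j).mul
      analyticAt_const)
  exact ((ofMatrixL n).analyticAt _).comp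
    ((((NormedSpace.exp_analytic _).comp hG).mul hx).mul
      ((NormedSpace.exp_analytic _).comp hG.neg))

theorem hasDerivAt_flow (m j : ℕ) (hm : m ≤ n) (hj : j ≤ m) (x : Mat n) :
    HasDerivAt (fun z => flow m j z x) (ham (tracePoly (m - j) m hm) x) 0 := by
  have h0 : ham (tracePoly (m - j) m hm) x = ofMatrixL n
      (blockPow (toMatrixL n x) m j * toMatrixL n x +
        toMatrixL n x * (-blockPow (toMatrixL n x) m j)) := by
    have := ham_tracePoly (m - j) m hm (Nat.sub_le _ _) x
    rw [Nat.sub_sub_self hj] at this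
    rw [mul_neg, ← sub_eq_add_neg]
    exact congrArg Matrix.of.symm this
  rw [h0]
  simp only [flow_eq]
  set G := blockPow (toMatrixL n x) m j
  have h1 : HasDerivAt (fun z : ℂ => NormedSpace.exp (z • G)) G 0 := by
    have h := hasDerivAt_exp_smul_const (𝕂 := ℂ) G (0 : ℂ)
    rw [zero_smul, NormedSpace.exp_zero, one_mul] at h
    exact h
  have h2 : HasDerivAt (fun z : ℂ => NormedSpace.exp (-(z • G))) (-G) 0 := by
    have h := hasDerivAt_exp_smul_const (𝕂 := ℂ) (-G) (0 : ℂ)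
    rw [zero_smul, NormedSpace.exp_zero, one_mul] at h
    simp only [smul_neg] at h
    exact h
  have h3 := (h1.mul_const (toMatrixL n x)).mul h2
  have h4 := (ofMatrixL n).hasFDerivAt.comp_hasDerivAt (0 : ℂ) h3
  simp only [zero_smul, neg_zero, NormedSpace.exp_zero, one_mul, mul_one] at h4
  exact h4

end Flow

/-! ### Actions of vector groups -/

/-- A holomorphic action of the vector group `W` on `M(n)`. -/
structure IsHolAction {W : Type*} [NormedAddCommGroup W] [NormedSpace ℂ W] {n : ℕ}
    (σ : W → Mat n → Mat n) : Prop where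
  zero : ∀ x, σ 0 x = x
  add : ∀ a b x, σ (a + b) x = σ a (σ b x)
  holo : ∀ q, AnalyticAt ℂ (fun q : W × Mat n => σ q.1 q.2) q

/-- Commuting one-parameter groups combine into an action of their product. The last clause says
that whatever is preserved by the one-parameter groups is preserved by the action. -/
theorem exists_action_of_commuting_flows {ι : Type*} [Fintype ι] [DecidableEq ι] {n : ℕ}
    (φ : ι → ℂ → Mat n → Mat n) (hφ : ∀ i, IsHolAction (φ i))
    (hc : ∀ i k z w x, φ i z (φ k w x) = φ k w (φ i z x)) :
    ∃ σ : (ι → ℂ) → Mat n → Mat n, IsHolAction σ ∧ (∀ i z x, σ (Pi.single i z) x = φ i z x) ∧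
      ∀ P : Mat n → Prop, (∀ i z x, P x → P (φ i z x)) → ∀ c x, P x → P (σ c x) := by
  -- Compose the flows one at a time; `s` is the set of indices already included.
  suffices h : ∀ s : Finset ι, ∃ σ : (ι → ℂ) → Mat n → Mat n, IsHolAction σ ∧
      (∀ i z x, σ (Pi.single i z) x = if i ∈ s then φ i z x else x) ∧
      (∀ c i z x, σ c (φ i z x) = φ i z (σ c x)) ∧
      ∀ P : Mat n → Prop, (∀ i z x, P x → P (φ i z x)) → ∀ c x, P x → P (σ c x) by
    obtain ⟨σ, h1, h2, _, h4⟩ := h Finset.univ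
    exact ⟨σ, h1, fun i z x => by simpa using h2 i z x, h4⟩
  intro s
  induction s using Finset.induction with
  | empty =>
    exact ⟨fun _ x => x, ⟨fun _ => rfl, fun _ _ _ => rfl, fun _ => analyticAt_snd⟩,
      fun _ _ _ => by simp, fun _ _ _ _ => rfl, fun _ _ _ _ h => h⟩
  | insert k s hk ih =>
    obtain ⟨σ, h1, h2, h3, h4⟩ := ih
    refine ⟨fun c x => φ k (c k) (σ c x), ⟨fun x => ?_, fun a b x => ?_, fun q => ?_⟩,
      fun i z x => ?_, fun c i z x => ?_, fun P hP c x hx => hP _ _ _ (h4 P hP c x hx)⟩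
    · rw [Pi.zero_apply, (hφ k).zero, h1.zero]
    · rw [Pi.add_apply, (hφ k).add, h1.add, h3]
    · have ha : AnalyticAt ℂ (fun q : (ι → ℂ) × Mat n => (q.1 k, σ q.1 q.2)) q :=
        (((ContinuousLinearMap.proj (R := ℂ) (φ := fun _ : ι => ℂ) k).analyticAt _).comp
          analyticAt_fst).prod (h1.holo q)
      exact ((hφ k).holo (q.1 k, σ q.1 q.2)).comp_of_eq ha rfl
    · change φ k _ (σ _ x) = _
      rw [h2]
      by_cases hik : i = k
      · subst hik; simp [hk]
      · simp [hik, (hφ k).zero]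
    · change φ k _ (σ _ _) = φ i z (φ k _ (σ _ _))
      rw [h3, hc]

/-- The index set of the basis of `𝔞`: `⟨m, j⟩` stands for `f_(m-j,m)`, `0 ≤ j < m < n`. The level
`m = n` is left out, its functions being Casimirs. -/
abbrev FieldIndex (n : ℕ) : Type := (m : Fin n) × Fin m.val

/-- The function `f_(m-j,m)`. -/
noncomputable def basisPoly {n : ℕ} (κ : FieldIndex n) : Poly n :=
  tracePoly (κ.1.val - κ.2.val) κ.1.val κ.1.isLt.le

theorem basisPoly_mem_J {n : ℕ} (κ : FieldIndex n) : basisPoly κ ∈ J n :=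
  tracePoly_mem_J _ _ (by have := κ.2.isLt; omega) _

theorem exists_basis_action (n : ℕ) :
    ∃ σ : (FieldIndex n → ℂ) → Mat n → Mat n, IsHolAction σ ∧
      (∀ κ z x, σ (Pi.single κ z) x = flow κ.1 κ.2 z x) ∧
      ∀ P : Mat n → Prop, (∀ (κ : FieldIndex n) z x, P x → P (flow κ.1 κ.2 z x)) →
        ∀ c x, P x → P (σ c x) :=
  exists_action_of_commuting_flows
    (fun (κ : FieldIndex n) z (x : Mat n) => flow κ.1 κ.2 z x)
    (fun _ => ⟨flow_zero _ _, flow_add _ _, analyticAt_flow _ _⟩)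
    (fun _ _ _ _ _ => flow_comm _ _ _ _ _ _ _)

/-- The derivative at `0` of the action is the combination of the basis fields. -/
theorem hasFDerivAt_basis_action {n : ℕ} {σ : (FieldIndex n → ℂ) → Mat n → Mat n}
    (h1 : IsHolAction σ) (h2 : ∀ κ z x, σ (Pi.single κ z) x = flow κ.1 κ.2 z x) (x : Mat n) :
    ∃ D : (FieldIndex n → ℂ) →L[ℂ] Mat n, HasFDerivAt (fun c => σ c x) D 0 ∧
      ∀ c, D c = ∑ κ, c κ • ham (basisPoly κ) x := by
  have ha : AnalyticAt ℂ (fun c => σ c x) 0 :=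
    (h1.holo (0, x)).comp_of_eq (f := fun c => (c, x)) (analyticAt_id.prod analyticAt_const) rfl
  have hD := ha.differentiableAt.hasFDerivAt
  refine ⟨_, hD, fun c => ?_⟩
  conv_lhs => rw [← Finset.univ_sum_single c, map_sum]
  refine Finset.sum_congr rfl fun κ _ => ?_
  have e : (Pi.single κ (c κ) : FieldIndex n → ℂ) = c κ • Pi.single κ 1 := by
    rw [← Pi.single_smul', smul_eq_mul, mul_one]
  rw [e, map_smul]
  congr 1
  have h3 : HasDerivAt (fun z : ℂ => z • (Pi.single κ 1 : FieldIndex n → ℂ)) (Pi.single κ 1) 0 := by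
    simpa using (hasDerivAt_id (0 : ℂ)).smul_const (Pi.single κ 1 : FieldIndex n → ℂ)
  have h4 := (show HasFDerivAt (fun c => σ c x) _ ((0 : ℂ) • (Pi.single κ 1 : FieldIndex n → ℂ)) by
    rw [zero_smul]; exact hD).comp_hasDerivAt (0 : ℂ) h3
  have h5 := hasDerivAt_flow κ.1.val κ.2.val κ.1.isLt.le κ.2.isLt.le x
  refine h4.unique (h5.congr_of_eventuallyEq (Filter.Eventually.of_forall fun z => ?_))
  change σ (z • Pi.single κ 1) x = _
  rw [← Pi.single_smul', smul_eq_mul, mul_one, h2]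

/-! ### Hamiltonian fields of the functions in `J(n)` -/

/-- The Hamiltonian field of a function in `J(n)` is a combination of the basis fields whose
coefficients are again in `J(n)`, hence constant along the flows. -/
theorem exists_ham_eq_sum {n : ℕ} {p : Poly n} (hp : p ∈ J n) :
    ∃ c : FieldIndex n → Poly n, (∀ κ, c κ ∈ J n) ∧
      ∀ x, ham p x = ∑ κ, evalAt x (c κ) • ham (basisPoly κ) x := by
  have hJ : Algebra.adjoin ℂ {p : Poly n | ∃ (k m : ℕ) (h : m ≤ n), 1 ≤ k ∧ k ≤ m ∧
      p = tracePoly k m h} ≤ J n := by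
    refine Algebra.adjoin_le ?_
    rintro q ⟨k, m, h, hk, hkm, rfl⟩
    exact tracePoly_mem_J k m (hk.trans hkm) h
  have h := J_le_adjoin_tracePoly n hp
  clear hp
  induction h using Algebra.adjoin_induction with
  | mem p hp =>
    obtain ⟨k, m, hm, hk, hkm, rfl⟩ := hp
    rcases hm.lt_or_eq with hlt | rfl
    · let κ : FieldIndex n := ⟨⟨m, hlt⟩, ⟨m - k, by simp only; omega⟩⟩
      refine ⟨Pi.single κ 1, fun κ' => ?_, fun x => ?_⟩
      · rw [Pi.single_apply]; split_ifs
        · exact one_mem _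
        · exact zero_mem _
      · rw [Finset.sum_eq_single κ]
        · have : basisPoly κ = tracePoly k m hm := by
            simp only [basisPoly, κ, Nat.sub_sub_self hkm]
          rw [this]; simp [evalAt]
        · intro b _ hb; simp [hb, evalAt]
        · simp
    · exact ⟨0, fun _ => zero_mem _, fun x => by simp [ham_tracePoly_self k hkm, evalAt]⟩
  | algebraMap r =>
    exact ⟨0, fun _ => zero_mem _, fun x => by
      rw [MvPolynomial.algebraMap_eq, ham_C]; simp [evalAt]⟩
  | add p q _ _ hp hq =>
    obtain ⟨c, hc, hp⟩ := hp
    obtain ⟨d, hd, hq⟩ := hq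
    exact ⟨c + d, fun κ => add_mem (hc κ) (hd κ), fun x => by
      simp [ham_add, hp, hq, evalAt_add, add_smul, Finset.sum_add_distrib]⟩
  | mul p q hp' hq' hp hq =>
    obtain ⟨c, hc, hp⟩ := hp
    obtain ⟨d, hd, hq⟩ := hq
    refine ⟨fun κ => p * d κ + q * c κ, fun κ => add_mem (mul_mem (hJ hp') (hd κ))
      (mul_mem (hJ hq') (hc κ)), fun x => ?_⟩
    simp only [ham_mul, hp, hq, evalAt_add, evalAt_mul, add_smul, Finset.sum_add_distrib,
      Finset.smul_sum, mul_smul]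

theorem hasDerivAt_basis_flow {n : ℕ} (κ : FieldIndex n) (z : ℂ) (x : Mat n) :
    HasDerivAt (fun z => flow κ.1.val κ.2.val z x)
      (ham (basisPoly κ) (flow κ.1.val κ.2.val z x)) z := by
  have h := hasDerivAt_flow κ.1.val κ.2.val κ.1.isLt.le κ.2.isLt.le (flow κ.1.val κ.2.val z x)
  rw [← sub_self z] at h
  have h2 := h.comp_sub_const z z
  refine h2.congr_of_eventuallyEq (Filter.Eventually.of_forall fun w => ?_)
  change _ = flow κ.1.val κ.2.val (w - z) _
  rw [← flow_add, sub_add_cancel]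

theorem hasDerivAt_evalAt_flow {n : ℕ} (f : Poly n) (κ : FieldIndex n) (z : ℂ) (x : Mat n) :
    HasDerivAt (fun z => evalAt (flow κ.1.val κ.2.val z x) f)
      (evalAt (flow κ.1.val κ.2.val z x) (poisson (basisPoly κ) f)) z := by
  rw [evalAt_poisson]
  exact (hasFDerivAt_evalAt f _).comp_hasDerivAt z (hasDerivAt_basis_flow κ z x)

/-- A function that Poisson commutes with `f_(m-j,m)` is constant along its flow. -/
theorem evalAt_flow_of_poisson_eq_zero {n : ℕ} {f : Poly n} {κ : FieldIndex n}
    (hf : poisson (basisPoly κ) f = 0) (z : ℂ) (x : Mat n) :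
    evalAt (flow κ.1.val κ.2.val z x) f = evalAt x f := by
  have h : ∀ w, HasDerivAt (fun z => evalAt (flow κ.1.val κ.2.val z x) f) 0 w := by
    intro w
    have := hasDerivAt_evalAt_flow f κ w x
    rw [hf] at this
    simpa [evalAt] using this
  have := is_const_of_deriv_eq_zero (fun w => (h w).differentiableAt) (fun w => (h w).deriv) z 0
  simpa only [flow_zero] using this

theorem poisson_basisPoly_eq_zero {n : ℕ} {q : Poly n} (hq : q ∈ J n) (κ : FieldIndex n) :
    poisson (basisPoly κ) q = 0 := by
  refine eq_of_evalAt fun x => ?_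
  have h := hasDerivAt_evalAt_flow q κ 0 x
  simp only [evalAt_flow hq, flow_zero] at h
  rw [h.unique (hasDerivAt_const _ _)]
  simp [evalAt]

/-- `J(n)` is Poisson commutative. -/
theorem poisson_eq_zero_of_mem_J {n : ℕ} {p q : Poly n} (hp : p ∈ J n) (hq : q ∈ J n) :
    poisson p q = 0 := by
  refine eq_of_evalAt fun x => ?_
  obtain ⟨c, _, hc⟩ := exists_ham_eq_sum hp
  rw [evalAt_poisson, hc, map_sum]
  rw [Finset.sum_eq_zero]
  · simp [evalAt]
  · intro κ _
    rw [map_smul, ← evalAt_poisson, poisson_basisPoly_eq_zero hq]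
    simp [evalAt]

/-! ### The basis fields at the shift -/

theorem sum_ite_val_eq {n : ℕ} (f : Fin n → ℂ) (k : ℕ) :
    (∑ c : Fin n, if c.val = k then f c else 0) = if h : k < n then f ⟨k, h⟩ else 0 := by
  split_ifs with h
  · rw [Finset.sum_eq_single (⟨k, h⟩ : Fin n)]
    · simp
    · intro b _ hb
      rw [if_neg (fun h' => hb (Fin.ext h'))]
    · simp
  · refine Finset.sum_eq_zero fun c _ => if_neg ?_
    have := c.isLt; omega

/-- The powers of the leading blocks of the shift are truncated powers of the shift. -/
theorem blockPow_shift {n : ℕ} (m j : ℕ) (a b : Fin n) :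
    blockPow (Matrix.of (shift n)) m j a b = if a.val = b.val + j ∧ a.val < m then 1 else 0 := by
  induction j generalizing a with
  | zero =>
    rw [blockPow_zero, blockProj, Matrix.diagonal_apply]
    simp only [Fin.ext_iff, add_zero, ite_and]
  | succ j ih =>
    rw [blockPow_succ, Matrix.mul_apply]
    have h1 : ∀ c : Fin n, (blockProj ℂ n m * Matrix.of (shift n) * blockProj ℂ n m) a c *
        blockPow (Matrix.of (shift n)) m j c b =
        if c.val = b.val + j then (if a.val = b.val + (j + 1) ∧ a.val < m then 1 else 0)
        else 0 := by
      intro c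
      rw [ih, blockProj, Matrix.mul_diagonal, Matrix.diagonal_mul, Matrix.of_apply, shift]
      split_ifs <;> first | omega | simp
    simp only [h1]
    rw [sum_ite_val_eq]
    split_ifs <;> first | omega | rfl

/-- At the shift the basis fields are, up to sign, the matrix units below the diagonal. -/
theorem ham_basisPoly_shift {n : ℕ} (κ : FieldIndex n) (a b : Fin n) :
    ham (basisPoly κ) (shift n) a b =
      if a.val = κ.1.val ∧ b.val + κ.2.val + 1 = κ.1.val then -1 else 0 := by
  have hj := κ.2.isLt
  have hm := κ.1.isLt
  have h := congrFun (congrFun (ham_tracePoly (κ.1.val - κ.2.val) κ.1.val κ.1.isLt.le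
    (Nat.sub_le _ _) (shift n)) a) b
  rw [Nat.sub_sub_self hj.le, Matrix.sub_apply, Matrix.mul_apply, Matrix.mul_apply] at h
  rw [show ham (basisPoly κ) (shift n) a b = _ from h]
  have h1 : ∀ c : Fin n, blockPow (Matrix.of (shift n)) κ.1.val κ.2.val a c *
      Matrix.of (shift n) c b = if c.val = b.val + 1 then
        (if a.val = b.val + 1 + κ.2.val ∧ a.val < κ.1.val then 1 else 0) else 0 := by
    intro c
    rw [blockPow_shift, Matrix.of_apply, shift]
    split_ifs <;> first | omega | simp
  have h2 : ∀ c : Fin n, Matrix.of (shift n) a c *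
      blockPow (Matrix.of (shift n)) κ.1.val κ.2.val c b = if c.val = b.val + κ.2.val then
        (if a.val = b.val + κ.2.val + 1 ∧ a.val < κ.1.val + 1 then 1 else 0) else 0 := by
    intro c
    rw [blockPow_shift, Matrix.of_apply, shift]
    split_ifs <;> first | omega | simp
  simp only [h1, h2]
  rw [sum_ite_val_eq, sum_ite_val_eq]
  have := a.isLt
  split_ifs <;> first | omega | simp

/-- The basis fields are linearly independent, already at the shift. -/
theorem linearIndependent_ham_basisPoly (n : ℕ) :
    LinearIndependent ℂ (fun κ : FieldIndex n => ham (basisPoly κ)) := by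
  rw [Fintype.linearIndependent_iff]
  intro g hg κ
  have hj := κ.2.isLt
  have hm := κ.1.isLt
  have h := congrFun (congrFun (congrFun hg (shift n)) κ.1) ⟨κ.1.val - 1 - κ.2.val, by omega⟩
  simp only [Finset.sum_apply, Pi.smul_apply, ham_basisPoly_shift, Pi.zero_apply] at h
  rw [Finset.sum_eq_single κ] at h
  · rw [if_pos ⟨rfl, by omega⟩] at h
    simpa using h
  · rintro ⟨m, j⟩ _ hb
    rw [if_neg, smul_zero]
    rintro ⟨h1, h2⟩
    simp only at h1 h2
    apply hb
    obtain ⟨⟨m', hm'⟩, ⟨j', hj'⟩⟩ := κ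
    obtain ⟨m, hm⟩ := m
    obtain ⟨j, hj⟩ := j
    simp only at h1 h2 hj'
    subst h1
    have : j = j' := by omega
    subst this
    rfl
  · simp

/-- The index of the basis field which is minus the matrix unit `(a, b)`, `b < a`. -/
def lowerIndex {n : ℕ} (a b : Fin n) (h : b < a) : FieldIndex n :=
  ⟨a, ⟨a.val - 1 - b.val, by have : b.val < a.val := h; omega⟩⟩

/-- The position below the diagonal attached to a basis field. -/
def lowerPos {n : ℕ} (κ : FieldIndex n) : Fin n :=
  ⟨κ.1.val - 1 - κ.2.val, by have := κ.1.isLt; omega⟩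

/-- The map `c ↦ σ (lower part of -c) (shift + upper part of c)` is open at `0`, since its
derivative there is the identity. -/
theorem map_nhds_shift {n : ℕ} {σ : (FieldIndex n → ℂ) → Mat n → Mat n}
    (h1 : IsHolAction σ) (h2 : ∀ κ z x, σ (Pi.single κ z) x = flow κ.1 κ.2 z x) :
    Filter.map (fun c : Mat n => σ (fun κ => -c κ.1 (lowerPos κ))
      (shift n + fun i j => if i ≤ j then c i j else 0)) (nhds 0) = nhds (shift n) := by
  let lower : Mat n →L[ℂ] (FieldIndex n → ℂ) :=
    ContinuousLinearMap.pi fun κ => -coord (κ.1, lowerPos κ)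
  let upper : Mat n →L[ℂ] Mat n := ContinuousLinearMap.pi fun i => ContinuousLinearMap.pi fun j =>
    if i ≤ j then coord (i, j) else 0
  have hup : ∀ c i j, upper c i j = if i ≤ j then c i j else 0 := by
    intro c i j
    simp only [upper, ContinuousLinearMap.coe_pi']
    split_ifs <;> rfl
  have hS : HasStrictFDerivAt (fun q : (FieldIndex n → ℂ) × Mat n => σ q.1 q.2) _ (0, shift n) :=
    (h1.holo (0, shift n)).hasStrictFDerivAt
  set D := fderiv ℂ (fun q : (FieldIndex n → ℂ) × Mat n => σ q.1 q.2) (0, shift n)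
  obtain ⟨D1, hD1, hD1'⟩ := hasFDerivAt_basis_action h1 h2 (shift n)
  have hinl : ∀ c, D (c, 0) = D1 c := by
    intro c
    have h3 : HasFDerivAt (fun c : FieldIndex n → ℂ => (c, shift n))
      (ContinuousLinearMap.inl ℂ (FieldIndex n → ℂ) (Mat n)) 0 :=
      hasFDerivAt_prodMk_left _ _
    have h4 := hS.hasFDerivAt.comp (0 : FieldIndex n → ℂ) h3
    exact congrArg (fun L : (FieldIndex n → ℂ) →L[ℂ] Mat n => L c) (h4.unique hD1)
  have hinr : ∀ v, D (0, v) = v := by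
    intro v
    have h3 : HasFDerivAt (fun v : Mat n => ((0 : FieldIndex n → ℂ), v))
      (ContinuousLinearMap.inr ℂ (FieldIndex n → ℂ) (Mat n)) (shift n) :=
      hasFDerivAt_prodMk_right _ _
    have h4 := hS.hasFDerivAt.comp (shift n) h3
    have h5 : HasFDerivAt ((fun q : (FieldIndex n → ℂ) × Mat n => σ q.1 q.2) ∘
        fun v : Mat n => ((0 : FieldIndex n → ℂ), v)) (ContinuousLinearMap.id ℂ (Mat n))
        (shift n) := by
      have : ((fun q : (FieldIndex n → ℂ) × Mat n => σ q.1 q.2) ∘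
        fun v : Mat n => ((0 : FieldIndex n → ℂ), v)) = id := by
        funext v; exact h1.zero v
      rw [this]; exact hasFDerivAt_id _
    exact congrArg (fun L : Mat n →L[ℂ] Mat n => L v) (h4.unique h5)
  have hF : HasStrictFDerivAt (fun c : Mat n => (lower c, shift n + upper c))
      (lower.prod upper) 0 :=
    lower.hasStrictFDerivAt.prodMk (upper.hasStrictFDerivAt.const_add _)
  have h6 := (show HasStrictFDerivAt (fun q : (FieldIndex n → ℂ) × Mat n => σ q.1 q.2) D
    (lower 0, shift n + upper 0) by simpa using hS).comp (0 : Mat n) hF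
  -- By `ham_basisPoly_shift` the fields supply the part below the diagonal.
  have h7 : D.comp (lower.prod upper) =
      ((ContinuousLinearEquiv.refl ℂ (Mat n) : Mat n ≃L[ℂ] Mat n) : Mat n →L[ℂ] Mat n) := by
    ext c : 1
    have e : D (lower c, upper c) = D1 (lower c) + upper c := by
      rw [← hinl, ← hinr (upper c), ← map_add, hinr]
      simp
    change D (lower c, upper c) = c
    rw [e, hD1']
    funext a b
    rw [Pi.add_apply, Pi.add_apply, hup, Finset.sum_apply, Finset.sum_apply]
    simp only [Pi.smul_apply, ham_basisPoly_shift]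
    by_cases hab : a ≤ b
    · rw [if_pos hab, Finset.sum_eq_zero, zero_add]
      intro κ _
      have : a.val ≤ b.val := hab
      rw [if_neg (by omega), smul_zero]
    · have hab' : b.val < a.val := not_le.mp hab
      rw [if_neg hab, add_zero, Finset.sum_eq_single (lowerIndex a b (not_le.mp hab))]
      · rw [if_pos ⟨rfl, by simp only [lowerIndex]; omega⟩]
        have : lowerPos (lowerIndex a b (not_le.mp hab)) = b := by
          apply Fin.ext; simp only [lowerPos, lowerIndex]; omega
        change -c a (lowerPos (lowerIndex a b (not_le.mp hab))) • (-1 : ℂ) = _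
        rw [this]; simp
      · rintro ⟨m, j⟩ _ hκ
        rw [if_neg, smul_zero]
        rintro ⟨h8, h9⟩
        apply hκ
        simp only at h8 h9
        obtain rfl : a = m := Fin.ext h8
        simp only [lowerIndex]
        congr 1
        apply Fin.ext
        simp only; omega
      · simp
  rw [h7] at h6
  have h8 := h6.map_nhds_eq_of_equiv
  have h9 : ((fun q : (FieldIndex n → ℂ) × Mat n => σ q.1 q.2) ∘
      fun c : Mat n => (lower c, shift n + upper c)) = (fun c : Mat n =>
      σ (fun κ => -c κ.1 (lowerPos κ)) (shift n + fun i j => if i ≤ j then c i j else 0)) := by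
    funext c
    change σ (lower c) (shift n + upper c) = _
    congr 2
    funext i j
    exact hup c i j
  rw [← h9]
  refine h8.trans ?_
  congr 1
  change σ (fun κ => -(0 : ℂ)) _ = _
  have e1 : (fun _ : FieldIndex n => -(0 : ℂ)) = 0 := by funext; simp
  rw [e1, h1.zero]
  funext i j
  simp

/-- The identity theorem for polynomial functions. -/
theorem eq_zero_of_eventually_evalAt_eq_zero {n : ℕ} {h : Poly n} {x : Mat n}
    (hx : ∀ᶠ y in nhds x, evalAt y h = 0) : h = 0 := by
  refine eq_of_evalAt fun y => ?_
  have h1 : AnalyticOnNhd ℂ (fun y : Mat n => evalAt y h) Set.univ :=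
    fun y _ => analyticAt_evalAt h y
  have h2 := h1.eqOn_zero_of_preconnected_of_eventuallyEq_zero isPreconnected_univ
    (Set.mem_univ x) hx (Set.mem_univ y)
  rw [show evalAt y h = 0 from h2]; simp [evalAt]

/-! ### Hessenberg matrices and maximality -/

section Hessenberg

open Polynomial

variable {R : Type*} [CommRing R]

/-- The characteristic polynomial of the leading `m × m` block of an infinite matrix. -/
noncomputable def leadingCharpoly (y : ℕ → ℕ → R) (m : ℕ) : R[X] :=
  (Matrix.of fun i j : Fin m => y i j).charpoly

theorem leadingCharpoly_zero (y : ℕ → ℕ → R) : leadingCharpoly y 0 = 1 := by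
  simp [leadingCharpoly, Matrix.charpoly]

theorem leadingCharpoly_monic (y : ℕ → ℕ → R) (m : ℕ) : (leadingCharpoly y m).Monic :=
  Matrix.charpoly_monic _

theorem leadingCharpoly_natDegree [Nontrivial R] (y : ℕ → ℕ → R) (m : ℕ) :
    (leadingCharpoly y m).natDegree = m := by
  rw [leadingCharpoly, Matrix.charpoly_natDegree_eq_dim, Fintype.card_fin]

/-- The recursion for the characteristic polynomials of the leading blocks of a Hessenberg matrix.
The row vector `v` of the earlier characteristic polynomials satisfies `v (λ - y) = (0, …, 0, Q)`,
where `Q` is the right hand side; multiplying by the adjugate, the determinant is `Q` times a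
monic polynomial of degree zero. -/
theorem leadingCharpoly_succ {y : ℕ → ℕ → R} (h1 : ∀ j, y (j + 1) j = 1)
    (h0 : ∀ i j, j + 1 < i → y i j = 0) (m : ℕ) :
    leadingCharpoly y (m + 1) = X * leadingCharpoly y m -
      ∑ i ∈ Finset.range (m + 1), C (y i m) * leadingCharpoly y i := by
  nontriviality R
  induction m using Nat.strong_induction_on with
  | _ m ih =>
  set Q := X * leadingCharpoly y m -
      ∑ i ∈ Finset.range (m + 1), C (y i m) * leadingCharpoly y i with hQ
  set A : Matrix (Fin (m + 1)) (Fin (m + 1)) R := Matrix.of fun i j => y i j with hA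
  let v : Fin (m + 1) → R[X] := fun i => leadingCharpoly y i
  have hcol : ∀ j : Fin (m + 1), Matrix.vecMul v A.charmatrix j =
      X * leadingCharpoly y j - ∑ i ∈ Finset.range (m + 1), C (y i j) * leadingCharpoly y i := by
    intro j
    rw [Matrix.charmatrix, Matrix.vecMul_sub, Pi.sub_apply, Matrix.scalar_apply,
      Matrix.vecMul_diagonal, mul_comm,
      ← Fin.sum_univ_eq_sum_range (fun i => C (y i j) * leadingCharpoly y i)]
    congr 1
    change ∑ i, v i * C (A i j) = _
    exact Finset.sum_congr rfl fun i _ => mul_comm (leadingCharpoly y i) (C (y i j))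
  have hv : Matrix.vecMul v A.charmatrix = Pi.single (Fin.last m) Q := by
    funext j
    rw [hcol]
    by_cases hj : j = Fin.last m
    · subst hj; simp [hQ]
    · have hj' : j.val < m := Fin.val_lt_last hj
      rw [Pi.single_eq_of_ne hj]
      have h3 : ∑ i ∈ Finset.range (m + 1), C (y i j) * leadingCharpoly y i =
          ∑ i ∈ Finset.range (j.val + 2), C (y i j) * leadingCharpoly y i := by
        symm
        refine Finset.sum_subset (fun i hi => ?_) (fun i _ hi => ?_)
        · rw [Finset.mem_range] at hi ⊢; omega
        · rw [Finset.mem_range] at hi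
          rw [h0 i j (by omega)]; simp
      rw [h3, Finset.sum_range_succ, h1, ih j.val hj']
      simp
  have hdet : leadingCharpoly y (m + 1) = Q * A.charmatrix.adjugate (Fin.last m) 0 := by
    have h3 := congrArg (fun w => Matrix.vecMul w A.charmatrix.adjugate 0) hv
    simp only [Matrix.vecMul_vecMul, Matrix.mul_adjugate, Matrix.single_vecMul,
      Matrix.vecMul_smul, Matrix.vecMul_one] at h3
    have hv0 : v 0 = 1 := leadingCharpoly_zero y
    rw [Pi.smul_apply, hv0, smul_eq_mul, mul_one] at h3
    change A.charmatrix.det = _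
    simpa using h3
  have hQm : Q.Monic ∧ Q.natDegree = m + 1 := by
    have hd : (X * leadingCharpoly y m).natDegree = m + 1 := by
      rw [natDegree_X_mul (leadingCharpoly_monic y m).ne_zero, leadingCharpoly_natDegree]
    have hlt : (∑ i ∈ Finset.range (m + 1), C (y i m) * leadingCharpoly y i).degree <
        (X * leadingCharpoly y m).degree := by
      rw [degree_eq_natDegree (monic_X.mul (leadingCharpoly_monic y m)).ne_zero, hd]
      refine (degree_sum_le _ _).trans_lt ?_
      rw [Finset.sup_lt_iff (WithBot.bot_lt_coe _)]
      intro i hi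
      rw [Finset.mem_range] at hi
      refine (degree_mul_le _ _).trans_lt ((add_le_add_left degree_C_le _).trans_lt ?_)
      rw [zero_add, degree_eq_natDegree (leadingCharpoly_monic y i).ne_zero,
        leadingCharpoly_natDegree]
      exact_mod_cast hi
    refine ⟨(monic_X.mul (leadingCharpoly_monic y m)).sub_of_left hlt, ?_⟩
    rw [hQ, natDegree_eq_of_degree_eq (degree_sub_eq_left_of_degree_lt hlt), hd]
  -- Both sides of `hdet` have degree `m + 1`, so the cofactor is monic of degree `0`.
  have hmon : (A.charmatrix.adjugate (Fin.last m) 0).Monic := by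
    refine hQm.1.of_mul_monic_left ?_
    rw [← hdet]; exact leadingCharpoly_monic y _
  have hdeg : (A.charmatrix.adjugate (Fin.last m) 0).natDegree = 0 := by
    have h3 := leadingCharpoly_natDegree y (m + 1)
    rw [hdet, hQm.1.natDegree_mul hmon, hQm.2] at h3
    omega
  rw [hdet, hmon.natDegree_eq_zero.mp hdeg, mul_one]

/-- The entries of a Hessenberg matrix are polynomials in the coefficients of the characteristic
polynomials of its leading blocks: the recursion is solved for the entries of column `m` from the
diagonal upwards, since `leadingCharpoly y i` is monic of degree `i`. -/
theorem hessenberg_entry_mem [Algebra ℂ R] {y : ℕ → ℕ → R} (h1 : ∀ j, y (j + 1) j = 1)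
    (h0 : ∀ i j, j + 1 < i → y i j = 0) (T : Subalgebra ℂ R) (n : ℕ)
    (hT : ∀ m ≤ n, ∀ i, (leadingCharpoly y m).coeff i ∈ T) {i m : ℕ} (him : i ≤ m) (hm : m < n) :
    y i m ∈ T := by
  nontriviality R
  have key : ∀ d i, i + d = m → y i m ∈ T := by
    intro d
    induction d using Nat.strong_induction_on with
    | _ d ih =>
    intro i hi
    have h2 := congrArg (fun p => p.coeff i) (leadingCharpoly_succ h1 h0 m)
    simp only [coeff_sub, finsetSum_coeff, coeff_C_mul] at h2
    have h3 : (X * leadingCharpoly y m).coeff i ∈ T := by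
      cases i with
      | zero => rw [coeff_X_mul_zero]; exact zero_mem _
      | succ i => rw [coeff_X_mul]; exact hT m hm.le i
    rw [← Finset.add_sum_erase _ _ (Finset.mem_range.mpr (show i < m + 1 by omega))] at h2
    have h4 : (leadingCharpoly y i).coeff i = 1 := by
      have := (leadingCharpoly_monic y i).coeff_natDegree
      rwa [leadingCharpoly_natDegree] at this
    rw [h4, mul_one] at h2
    have h5 : ∑ l ∈ (Finset.range (m + 1)).erase i, y l m * (leadingCharpoly y l).coeff i ∈ T := by
      refine sum_mem fun l hl => ?_
      rw [Finset.mem_erase, Finset.mem_range] at hl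
      rcases lt_or_gt_of_ne hl.1 with h | h
      · rw [coeff_eq_zero_of_natDegree_lt (by rwa [leadingCharpoly_natDegree]), mul_zero]
        exact zero_mem _
      · exact mul_mem (ih (m - l) (by omega) l (by omega)) (hT l (by omega) i)
    have h6 : y i m = (X * leadingCharpoly y m).coeff i - (leadingCharpoly y (m + 1)).coeff i -
        ∑ l ∈ (Finset.range (m + 1)).erase i, y l m * (leadingCharpoly y l).coeff i := by
      linear_combination h2
    rw [h6]
    exact sub_mem (sub_mem h3 (hT _ hm i)) h5
  exact key (m - i) i (by omega)

end Hessenberg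

/-- The universal Hessenberg matrix: generic entries on and above the diagonal, ones just below
it; it is extended to an infinite matrix. -/
noncomputable def hessenberg (n : ℕ) (i j : ℕ) : Poly n :=
  if i = j + 1 then 1 else if h : i ≤ j ∧ j < n then
    MvPolynomial.X (⟨i, h.1.trans_lt h.2⟩, ⟨j, h.2⟩) else 0

/-- Restriction of polynomial functions to the Hessenberg matrices. -/
noncomputable def restrictHessenberg (n : ℕ) : Poly n →ₐ[ℂ] Poly n :=
  MvPolynomial.aeval fun ij : Fin n × Fin n => hessenberg n ij.1 ij.2

/-- Every polynomial function on the Hessenberg matrices is the restriction of a function in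
`J(n)`. -/
theorem restrictHessenberg_mem_map_J {n : ℕ} (f : Poly n) :
    restrictHessenberg n f ∈ (J n).map (restrictHessenberg n) := by
  set T := (J n).map (restrictHessenberg n)
  have hT : ∀ m ≤ n, ∀ i, (leadingCharpoly (hessenberg n) m).coeff i ∈ T := by
    intro m hm i
    rcases Nat.eq_zero_or_pos m with rfl | hpos
    · rw [leadingCharpoly_zero, Polynomial.coeff_one]
      split_ifs
      · exact one_mem _
      · exact zero_mem _
    · refine ⟨_, incl_charpoly_coeff_mem_J hpos hm i, ?_⟩
      have h1 : (Matrix.of fun i j : Fin m => hessenberg n i j) =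
          (Matrix.mvPolynomialX (Fin m) (Fin m) ℂ).map
            ((restrictHessenberg n).comp (incl hm) : Poly m →ₐ[ℂ] Poly n).toRingHom := by
        ext1 a b
        simp [Matrix.mvPolynomialX, restrictHessenberg, incl]
      rw [leadingCharpoly, h1, Matrix.charpoly_map, Polynomial.coeff_map]
      rfl
  rw [restrictHessenberg, MvPolynomial.aeval_eq_eval₂Hom, MvPolynomial.coe_eval₂Hom]
  refine MvPolynomial.eval₂_mem (s := T) (fun c _ => T.algebraMap_mem _) (fun ij => ?_)
  by_cases h : ij.1 ≤ ij.2
  · exact hessenberg_entry_mem (fun j => by simp [hessenberg])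
      (fun i j hij => by
        rw [hessenberg, if_neg (by omega), dif_neg (by omega)]) T n hT h ij.2.isLt
  · have h' : ij.2.val < ij.1.val := not_le.mp h
    rw [hessenberg, dif_neg (by omega)]
    split_ifs
    · exact one_mem _
    · exact zero_mem _

theorem evalAt_restrictHessenberg {n : ℕ} (f : Poly n) (c : Mat n) :
    evalAt c (restrictHessenberg n f) =
      evalAt (shift n + fun i j => if i ≤ j then c i j else 0) f := by
  rw [restrictHessenberg, evalAt, MvPolynomial.aeval_def, MvPolynomial.algebraMap_eq,
    MvPolynomial.hom_eval₂]
  have : (MvPolynomial.eval fun ij : Fin n × Fin n => c ij.1 ij.2).comp MvPolynomial.C =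
    RingHom.id ℂ := by ext z; simp
  rw [this, evalAt, MvPolynomial.eval]
  change _ = MvPolynomial.eval₂ _ _ _
  congr 1
  funext ij
  simp only [hessenberg, Pi.add_apply, shift]
  by_cases h1 : ij.1.val = ij.2.val + 1
  · have : ¬ ij.1 ≤ ij.2 := fun h => by have : ij.1.val ≤ ij.2.val := h; omega
    simp [h1, this]
  · by_cases h2 : ij.1 ≤ ij.2
    · have h3 : ij.1.val ≤ ij.2.val ∧ ij.2.val < n := ⟨h2, ij.2.isLt⟩
      simp [h1, h2]
    · have h3 : ¬ ij.1.val ≤ ij.2.val := h2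
      simp [h1, h2]

/-- `J(n)` is maximal Poisson commutative. If `f` commutes with `J(n)`, choose `g ∈ J(n)` with the
same restriction to the Hessenberg matrices. Then `f - g` is constant along the flows and vanishes
on the Hessenberg matrices, whose translates under the flows contain an open set. -/
theorem mem_J_of_poisson_eq_zero {n : ℕ} {f : Poly n} (hf : ∀ p ∈ J n, poisson f p = 0) :
    f ∈ J n := by
  obtain ⟨g, hg, hgf⟩ := restrictHessenberg_mem_map_J f
  obtain ⟨σ, h1, h2, h3⟩ := exists_basis_action n
  have hfg : ∀ κ : FieldIndex n, ∀ z x, evalAt (flow κ.1.val κ.2.val z x) (f - g) =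
      evalAt x (f - g) := by
    intro κ z x
    have e : ∀ y : Mat n, evalAt y (f - g) = evalAt y f - evalAt y g := fun y => map_sub _ _ _
    rw [e, e, evalAt_flow hg, evalAt_flow_of_poisson_eq_zero]
    rw [poisson_antisymm, hf _ (basisPoly_mem_J κ), neg_zero]
  have hσ : ∀ c x, evalAt (σ c x) (f - g) = evalAt x (f - g) := fun c x =>
    h3 (fun y => evalAt y (f - g) = evalAt x (f - g))
      (fun κ z y hy => (hfg κ z y).trans hy) c x rfl
  have h0 : f - g = 0 := by
    refine eq_zero_of_eventually_evalAt_eq_zero (x := shift n) ?_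
    rw [← map_nhds_shift h1 h2, Filter.eventually_map]
    refine Filter.Eventually.of_forall fun c => ?_
    rw [hσ, ← evalAt_restrictHessenberg, map_sub,
      show restrictHessenberg n g = restrictHessenberg n f from hgf, sub_self]
    simp [evalAt]
  rw [sub_eq_zero.mp h0]; exact hg

/-! ### Differentials of the orbit maps -/

section Orbits

variable {W : Type*} [NormedAddCommGroup W] [NormedSpace ℂ W] {n : ℕ} {σ : W → Mat n → Mat n}

/-- The differential at `0` of the orbit map `a ↦ σ a x`. -/
noncomputable def orbitDeriv (σ : W → Mat n → Mat n) (x : Mat n) : W →L[ℂ] Mat n :=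
  fderiv ℂ (fun a => σ a x) 0

namespace IsHolAction

theorem analyticAt_orbit (hσ : IsHolAction σ) (x : Mat n) (a : W) :
    AnalyticAt ℂ (fun a => σ a x) a :=
  (hσ.holo (a, x)).comp_of_eq (f := fun a => (a, x)) (analyticAt_id.prod analyticAt_const) rfl

theorem analyticAt_map (hσ : IsHolAction σ) (a : W) (x : Mat n) :
    AnalyticAt ℂ (fun x => σ a x) x :=
  (hσ.holo (a, x)).comp_of_eq (f := fun x => (a, x)) (analyticAt_const.prod analyticAt_id) rfl

theorem comm (hσ : IsHolAction σ) (a b : W) (x : Mat n) : σ a (σ b x) = σ b (σ a x) := by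
  rw [← hσ.add, add_comm, hσ.add]

theorem neg_apply (hσ : IsHolAction σ) (a : W) (x : Mat n) : σ (-a) (σ a x) = x := by
  rw [← hσ.add, neg_add_cancel, hσ.zero]

theorem hasFDerivAt_orbit_zero (hσ : IsHolAction σ) (x : Mat n) :
    HasFDerivAt (fun a => σ a x) (orbitDeriv σ x) 0 :=
  (hσ.analyticAt_orbit x 0).differentiableAt.hasFDerivAt

theorem hasFDerivAt_orbit (hσ : IsHolAction σ) (x : Mat n) (u : W) :
    HasFDerivAt (fun a => σ a x) (orbitDeriv σ (σ u x)) u := by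
  have h := hσ.hasFDerivAt_orbit_zero (σ u x)
  rw [← sub_self u] at h
  have h1 : HasFDerivAt (fun a : W => a - u) (ContinuousLinearMap.id ℂ W) u :=
    (hasFDerivAt_id u).sub_const u
  have h2 := HasFDerivAt.comp (f := fun a : W => a - u) u h h1
  rw [ContinuousLinearMap.comp_id] at h2
  refine h2.congr_of_eventuallyEq (Filter.Eventually.of_forall fun a => ?_)
  change _ = σ (a - u) (σ u x)
  rw [← hσ.add, sub_add_cancel]

theorem orbitDeriv_eq (hσ : IsHolAction σ) {a : W} {x v : Mat n}
    (h : HasDerivAt (fun z : ℂ => σ (z • a) x) v 0) : orbitDeriv σ x a = v := by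
  have h1 : HasDerivAt (fun z : ℂ => z • a) a 0 := by
    simpa using (hasDerivAt_id (0 : ℂ)).smul_const a
  have h2 := hσ.hasFDerivAt_orbit_zero x
  rw [← zero_smul ℂ a] at h2
  exact (HasFDerivAt.comp_hasDerivAt (f := fun z : ℂ => z • a) 0 h2 h1).unique h

theorem hasDerivAt_smul (hσ : IsHolAction σ) (a : W) (x : Mat n) (z : ℂ) :
    HasDerivAt (fun z : ℂ => σ (z • a) x) (orbitDeriv σ (σ (z • a) x) a) z := by
  have h1 : HasDerivAt (fun z : ℂ => z • a) a z := by
    simpa using (hasDerivAt_id z).smul_const a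
  exact HasFDerivAt.comp_hasDerivAt (f := fun z : ℂ => z • a) z
    (hσ.hasFDerivAt_orbit x (z • a)) h1

/-- The velocity fields of the action are invariant under it, the group being commutative. -/
theorem fderiv_orbitDeriv (hσ : IsHolAction σ) (u a : W) (x : Mat n) :
    fderiv ℂ (fun x => σ u x) x (orbitDeriv σ x a) = orbitDeriv σ (σ u x) a := by
  have h1 := (hσ.analyticAt_map u x).differentiableAt.hasFDerivAt
  have h2 := hσ.hasFDerivAt_orbit_zero x
  have h3 := HasFDerivAt.comp (g := fun x => σ u x) (f := fun a => σ a x) 0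
    (by rw [hσ.zero]; exact h1) h2
  have h4 := hσ.hasFDerivAt_orbit_zero (σ u x)
  have h5 : ((fun x => σ u x) ∘ fun a => σ a x) = fun a => σ a (σ u x) := by
    funext a; exact hσ.comm u a x
  rw [h5] at h3
  exact congrArg (fun L : W →L[ℂ] Mat n => L a) (h3.unique h4)

theorem orbitDeriv_apply_eq_zero_iff (hσ : IsHolAction σ) (u a : W) (x : Mat n) :
    orbitDeriv σ (σ u x) a = 0 ↔ orbitDeriv σ x a = 0 := by
  have key : ∀ (u : W) (x : Mat n), orbitDeriv σ x a = 0 → orbitDeriv σ (σ u x) a = 0 := by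
    intro u x h
    rw [← hσ.fderiv_orbitDeriv, h, map_zero]
  refine ⟨fun h => ?_, key u x⟩
  have := key (-u) _ h
  rwa [hσ.neg_apply] at this

/-- Directions with vanishing velocity at `x` lie in the stabilizer of `x`. -/
theorem apply_eq_of_orbitDeriv_eq_zero (hσ : IsHolAction σ) {a : W} {x : Mat n}
    (h : orbitDeriv σ x a = 0) : σ a x = x := by
  have h1 : ∀ z : ℂ, HasDerivAt (fun z : ℂ => σ (z • a) x) 0 z := by
    intro z
    have h2 := hσ.hasDerivAt_smul a x z
    rwa [(hσ.orbitDeriv_apply_eq_zero_iff (z • a) a x).mpr h] at h2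
  have h3 := is_const_of_deriv_eq_zero (fun z => (h1 z).differentiableAt)
    (fun z => (h1 z).deriv) 1 0
  simpa [hσ.zero] using h3

/-- The velocity fields of an action of a vector group commute: their brackets are the
antisymmetrization of a second derivative of the orbit map. -/
theorem lieBracket_eq_zero (hσ : IsHolAction σ) {ξ η : VField n} {a b : W}
    (hξ : ∀ x, orbitDeriv σ x a = ξ x) (hη : ∀ x, orbitDeriv σ x b = η x)
    (dξ : Differentiable ℂ ξ) (dη : Differentiable ℂ η) :
    VectorField.lieBracket ℂ ξ η = 0 := by
  have key : ∀ {η : VField n} {b : W} (_ : ∀ x, orbitDeriv σ x b = η x)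
      (_ : Differentiable ℂ η) (a : W) (x : Mat n),
      fderiv ℂ (fderiv ℂ fun c => σ c x) 0 a b = fderiv ℂ η x (orbitDeriv σ x a) := by
    intro η b hη dη a x
    have h1 : ∀ u, fderiv ℂ (fun c => σ c x) u b = η (σ u x) := fun u => by
      rw [(hσ.hasFDerivAt_orbit x u).fderiv, hη]
    have h2 : HasFDerivAt (fderiv ℂ fun c => σ c x) (fderiv ℂ (fderiv ℂ fun c => σ c x) 0) 0 :=
      (hσ.analyticAt_orbit x 0).fderiv.differentiableAt.hasFDerivAt
    have h3 := h2.clm_apply (hasFDerivAt_const b (0 : W))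
    have h4 := HasFDerivAt.comp (g := η) (f := fun c => σ c x) 0
      (dη (σ 0 x)).hasFDerivAt (hσ.hasFDerivAt_orbit_zero x)
    have h5 : (fun u => fderiv ℂ (fun c => σ c x) u b) = η ∘ fun c => σ c x := funext h1
    rw [h5] at h3
    have h6 := congrArg (fun L : W →L[ℂ] Mat n => L a) (h3.unique h4)
    simpa [hσ.zero] using h6
  funext x
  rw [VectorField.lieBracket, ← hξ x, ← hη x, ← key hη dη, ← key hξ dξ, Pi.zero_apply, sub_eq_zero]
  exact (((hσ.analyticAt_orbit x 0).contDiffAt (n := ω)).isSymmSndFDerivAt (by simp)) a b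

end IsHolAction

end Orbits

/-! ### Orbits are leaves -/

/-- The quotient of `ℂ^s` by a subgroup meeting some ball only in `0` is locally homeomorphic to
`ℂ^s`. -/
theorem isLocalHomeomorph_mk {s : ℕ} (Γ : AddSubgroup (Fin s → ℂ)) {r : ℝ} (hr : 0 < r)
    (hΓ : ∀ u ∈ Γ, ‖u‖ < r → u = 0) :
    IsLocalHomeomorph (QuotientAddGroup.mk : (Fin s → ℂ) → (Fin s → ℂ) ⧸ Γ) := by
  refine IsLocalHomeomorph.mk _ fun u => ?_
  have hinj : Set.InjOn (QuotientAddGroup.mk : (Fin s → ℂ) → (Fin s → ℂ) ⧸ Γ)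
      (Metric.ball u (r / 2)) := by
    intro v hv w hw hvw
    rw [QuotientAddGroup.eq] at hvw
    have h1 : ‖-v + w‖ < r := by
      rw [Metric.mem_ball] at hv hw
      rw [neg_add_eq_sub, ← dist_eq_norm]
      calc dist w v ≤ dist w u + dist u v := dist_triangle _ _ _
        _ < r := by rw [dist_comm u v]; linarith
    have h2 := hΓ _ hvw h1
    rwa [neg_add_eq_zero] at h2
  let e : PartialEquiv (Fin s → ℂ) ((Fin s → ℂ) ⧸ Γ) := hinj.toPartialEquiv _ _
  exact ⟨OpenPartialHomeomorph.ofContinuousOpen e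
    (QuotientAddGroup.continuous_mk.continuousOn)
    (QuotientAddGroup.isOpenMap_coe) Metric.isOpen_ball, Metric.mem_ball_self (half_pos hr),
    fun _ _ => rfl⟩

/-- The charts of the quotient of `ℂ^s` by a discrete subgroup: local inverses of the projection. -/
@[reducible] noncomputable def quotientChartedSpace {s : ℕ} {Γ : AddSubgroup (Fin s → ℂ)}
    (hπ : IsLocalHomeomorph (QuotientAddGroup.mk : (Fin s → ℂ) → (Fin s → ℂ) ⧸ Γ)) :
    ChartedSpace (Fin s → ℂ) ((Fin s → ℂ) ⧸ Γ) where
  atlas := Set.range fun u => hπ.localInverseAt u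
  chartAt q := hπ.localInverseAt q.out
  mem_chart_source q := by
    have := hπ.apply_self_mem_localInverseAt_source (x := q.out)
    rwa [QuotientAddGroup.out_eq'] at this
  chart_mem_atlas q := ⟨_, rfl⟩

/-- The transition maps are locally translations by elements of the discrete subgroup. -/
theorem isManifold_quotient {s : ℕ} {Γ : AddSubgroup (Fin s → ℂ)} {r : ℝ} (hr : 0 < r)
    (hΓ : ∀ u ∈ Γ, ‖u‖ < r → u = 0)
    (hπ : IsLocalHomeomorph (QuotientAddGroup.mk : (Fin s → ℂ) → (Fin s → ℂ) ⧸ Γ)) :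
    letI := quotientChartedSpace hπ
    IsManifold 𝓘(ℂ, Fin s → ℂ) ω ((Fin s → ℂ) ⧸ Γ) := by
  let _ := quotientChartedSpace hπ
  refine isManifold_of_contDiffOn _ _ _ ?_
  rintro _ _ ⟨u, rfl⟩ ⟨u', rfl⟩
  intro v hv
  have hv1 : v ∈ ((hπ.localInverseAt u).symm ≫ₕ hπ.localInverseAt u').source := hv.1
  set T := (hπ.localInverseAt u).symm ≫ₕ hπ.localInverseAt u' with hT
  have hTv : ∀ w ∈ T.source,
      (QuotientAddGroup.mk (T w) : (Fin s → ℂ) ⧸ Γ) = QuotientAddGroup.mk w := by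
    intro w hw
    rw [hT, OpenPartialHomeomorph.trans_source] at hw
    have h2 : (QuotientAddGroup.mk w : (Fin s → ℂ) ⧸ Γ) ∈ (hπ.localInverseAt u').source := by
      have := hw.2
      simpa using this
    have h3 := hπ.apply_localInverseAt_of_mem h2
    simpa [hT] using h3
  have hcont : ContinuousAt (fun w => T w - w) v :=
    (T.continuousAt hv1).sub continuousAt_id
  have hev : ∀ᶠ w in nhds v, T w = w + (T v - v) := by
    filter_upwards [T.open_source.mem_nhds hv1, hcont.eventually (Metric.ball_mem_nhds _ hr)]
      with w hw hw'
    have hmem : ∀ w ∈ T.source, T w - w ∈ Γ := by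
      intro w hw
      have := (QuotientAddGroup.eq (s := Γ)).mp (hTv w hw).symm
      rwa [neg_add_eq_sub] at this
    have h1 := hΓ _ (Γ.sub_mem (hmem w hw) (hmem v hv1)) (by
      rw [← dist_eq_norm]; exact hw')
    rw [sub_eq_zero] at h1
    rw [← h1]; abel
  refine ContDiffAt.contDiffWithinAt ?_
  refine ContDiffAt.congr_of_eventuallyEq (f := fun w => w + (T v - v))
    (contDiffAt_id.add contDiffAt_const) ?_
  exact hev

/-- An orbit of a holomorphic action of a vector group whose tangent spaces are the `V y` is a
leaf: it is the quotient of a complement of the infinitesimal stabilizer by a discrete group. -/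
theorem IsHolAction.isLeaf_range {W : Type*} [NormedAddCommGroup W] [NormedSpace ℂ W]
    [FiniteDimensional ℂ W] {n : ℕ} {σ : W → Mat n → Mat n} (hσ : IsHolAction σ)
    (hV : ∀ y, V y = Set.range (orbitDeriv σ y)) (x : Mat n) :
    IsLeaf (Set.range fun a => σ a x) := by
  obtain ⟨U, hU⟩ := Submodule.exists_isCompl (LinearMap.ker (orbitDeriv σ x).toLinearMap)
  let s := Module.finrank ℂ U
  let E : (Fin s → ℂ) ≃ₗ[ℂ] U := LinearEquiv.ofFinrankEq _ _ (by simp [s])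
  let β : (Fin s → ℂ) →L[ℂ] W := LinearMap.toContinuousLinearMap (U.subtype ∘ₗ E.toLinearMap)
  have hβU : ∀ u, β u ∈ U := fun u => (E u).2
  have hβinj : ∀ u, β u = 0 → u = 0 := by
    intro u hu
    have : E u = 0 := Subtype.ext hu
    simpa using this
  have hker : ∀ u, orbitDeriv σ x (β u) = 0 → u = 0 := by
    intro u hu
    refine hβinj u ?_
    have h1 : β u ∈ LinearMap.ker (orbitDeriv σ x).toLinearMap ⊓ U := ⟨hu, hβU u⟩
    rw [hU.inf_eq_bot] at h1
    exact h1
  have hdec : ∀ a : W, ∃ w u, orbitDeriv σ x w = 0 ∧ a = w + β u := by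
    intro a
    have h1 : a ∈ LinearMap.ker (orbitDeriv σ x).toLinearMap ⊔ U := by
      rw [hU.sup_eq_top]; trivial
    obtain ⟨w, hw, v, hv, rfl⟩ := Submodule.mem_sup.mp h1
    refine ⟨w, E.symm ⟨v, hv⟩, hw, ?_⟩
    have : β (E.symm ⟨v, hv⟩) = v := by
      change ((E (E.symm ⟨v, hv⟩) : U) : W) = v
      rw [E.apply_symm_apply]
    rw [this]
  -- The orbit map restricted to the complement is an immersion onto the orbit; `Γ` is its period
  -- group.
  let f : (Fin s → ℂ) → Mat n := fun u => σ (β u) x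
  have hfd : ∀ u, HasFDerivAt f ((orbitDeriv σ (f u)).comp β) u := fun u =>
    HasFDerivAt.comp (g := fun a => σ a x) u (hσ.hasFDerivAt_orbit x (β u)) β.hasFDerivAt
  have hfa : ∀ u, AnalyticAt ℂ f u := fun u =>
    (hσ.analyticAt_orbit x (β u)).comp (β.analyticAt u)
  have hinj : ∀ u, Function.Injective ((orbitDeriv σ (f u)).comp β) := by
    intro u
    rw [injective_iff_map_eq_zero]
    intro v hv
    exact hker v ((hσ.orbitDeriv_apply_eq_zero_iff (β u) (β v) x).mp hv)
  have hrange : ∀ u, Set.range ((orbitDeriv σ (f u)).comp β) = V (f u) := by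
    intro u
    rw [hV]
    apply Set.Subset.antisymm
    · rintro _ ⟨v, rfl⟩; exact ⟨β v, rfl⟩
    · rintro _ ⟨a, rfl⟩
      obtain ⟨w, v, hw, rfl⟩ := hdec a
      refine ⟨v, ?_⟩
      rw [map_add, (hσ.orbitDeriv_apply_eq_zero_iff (β u) w x).mpr hw, zero_add]
      rfl
  let Γ : AddSubgroup (Fin s → ℂ) :=
    { carrier := {u | f u = x}
      zero_mem' := by simp [f, hσ.zero]
      add_mem' := by
        intro u v (hu : f u = x) (hv : f v = x)
        change σ (β (u + v)) x = x
        rw [map_add, hσ.add, show σ (β v) x = x from hv]; exact hu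
      neg_mem' := by
        intro u (hu : f u = x)
        change σ (β (-u)) x = x
        conv_lhs => rw [← hu, map_neg]
        exact hσ.neg_apply _ _ }
  have hfΓ : ∀ u v, -u + v ∈ Γ ↔ f u = f v := by
    intro u v
    change σ (β (-u + v)) x = x ↔ σ (β u) x = σ (β v) x
    rw [map_add, hσ.add, map_neg]
    constructor
    · intro h
      have := congrArg (σ (β u)) h
      rw [← hσ.add, add_neg_cancel, hσ.zero] at this
      exact this.symm
    · intro h
      rw [← h, hσ.neg_apply]
  -- An immersion does not return to its value at `0` near `0`.
  obtain ⟨r, hr, hΓ⟩ : ∃ r : ℝ, 0 < r ∧ ∀ u ∈ Γ, ‖u‖ < r → u = 0 := by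
    obtain ⟨K, _, hK⟩ := LinearMap.exists_antilipschitzWith
      ((orbitDeriv σ (f 0)).comp β).toLinearMap (LinearMap.ker_eq_bot.mpr (hinj 0))
    have h1 := (hfd 0).eventually_ne (c := x) ⟨K, hK⟩
    rw [eventually_nhdsWithin_iff, Metric.eventually_nhds_iff] at h1
    obtain ⟨r, hr, h1⟩ := h1
    refine ⟨r, hr, fun u hu hur => ?_⟩
    by_contra hne
    exact h1 (by simpa using hur) hne hu
  have hπ := isLocalHomeomorph_mk Γ hr hΓ
  let _ := quotientChartedSpace hπ
  let ι : (Fin s → ℂ) ⧸ Γ → Mat n := Quotient.lift f (by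
    intro u v huv
    exact (hfΓ u v).mp (QuotientAddGroup.leftRel_apply.mp huv))
  have hιmk : ∀ u : Fin s → ℂ, ι (QuotientAddGroup.mk u) = f u := fun u => rfl
  have hιcont : Continuous ι := by
    refine Continuous.quotient_lift ?_ _
    exact continuous_iff_continuousAt.mpr fun u => (hfa u).continuousAt
  have hιinj : Function.Injective ι := by
    intro p q
    induction p using QuotientAddGroup.induction_on with | _ u => ?_
    induction q using QuotientAddGroup.induction_on with | _ v => ?_
    intro h
    exact QuotientAddGroup.eq.mpr ((hfΓ u v).mpr h)
  -- The inverse charts are the projection itself, so `ι` reads `f` in every chart.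
  have hwritten : ∀ q, writtenInExtChartAt 𝓘(ℂ, Fin s → ℂ) 𝓘(ℂ, Mat n) q ι = f := by
    intro q
    funext u
    simp only [writtenInExtChartAt, extChartAt, mfld_simps]
    change ι ((hπ.localInverseAt q.out).symm u) = f u
    rw [IsLocalHomeomorph.localInverseAt_symm, hιmk]
  have hchart : ∀ q, f (extChartAt 𝓘(ℂ, Fin s → ℂ) q q) = ι q := by
    intro q
    rw [← hιmk]
    congr 1
    exact hπ.apply_localInverseAt_of_mem (mem_chart_source (Fin s → ℂ) q)
  have hsmooth : ContMDiff 𝓘(ℂ, Fin s → ℂ) 𝓘(ℂ, Mat n) ω ι := by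
    intro q
    rw [contMDiffAt_iff]
    refine ⟨hιcont.continuousAt, ?_⟩
    have := hwritten q
    rw [writtenInExtChartAt] at this
    rw [this]
    exact (hfa _).contDiffAt.contDiffWithinAt
  have hmf : ∀ q, mfderiv 𝓘(ℂ, Fin s → ℂ) 𝓘(ℂ, Mat n) ι q =
      (orbitDeriv σ (ι q)).comp β := by
    intro q
    rw [((hsmooth q).mdifferentiableAt (by simp)).mfderiv, hwritten]
    rw [modelWithCornersSelf_coe, Set.range_id, fderivWithin_univ, (hfd _).fderiv, hchart]
  refine ⟨s, (Fin s → ℂ) ⧸ Γ, inferInstance, quotientChartedSpace hπ, ι,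
    T2Space.of_injective_continuous hιinj hιcont, ?_, isManifold_quotient hr hΓ hπ, hsmooth,
    hιinj, ?_, fun q => ?_⟩
  · exact hπ.isOpenMap.isQuotientMap hπ.continuous Quotient.mk_surjective |>.secondCountableTopology
      hπ.isOpenMap
  · apply Set.Subset.antisymm
    · rintro _ ⟨q, rfl⟩
      induction q using QuotientAddGroup.induction_on with | _ u => ?_
      exact ⟨β u, rfl⟩
    · rintro _ ⟨a, rfl⟩
      obtain ⟨w, u, hw, rfl⟩ := hdec a
      refine ⟨QuotientAddGroup.mk u, ?_⟩
      change σ (β u) x = σ (w + β u) x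
      rw [add_comm w, hσ.add, hσ.apply_eq_of_orbitDeriv_eq_zero hw]
  · rw [hmf, ← hchart]
    exact ⟨hinj _, hrange _⟩

/-! ### The Lie algebra `𝔞` -/

theorem lieA_eq_span (n : ℕ) :
    lieA n = Submodule.span ℂ (Set.range fun κ : FieldIndex n => ham (basisPoly κ)) := by
  apply le_antisymm
  · refine Submodule.span_le.mpr ?_
    rintro ξ ⟨k, m, hm, hk, hkm, rfl⟩
    rcases hm.lt_or_eq with hlt | rfl
    · refine Submodule.subset_span ⟨⟨⟨m, hlt⟩, ⟨m - k, by simp only; omega⟩⟩, ?_⟩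
      simp only [basisPoly, Nat.sub_sub_self hkm]
    · rw [ham_tracePoly_self k hkm]; exact zero_mem _
  · refine Submodule.span_le.mpr ?_
    rintro _ ⟨κ, rfl⟩
    have := κ.2.isLt
    exact Submodule.subset_span ⟨κ.1.val - κ.2.val, κ.1.val, κ.1.isLt.le, by omega, by omega, rfl⟩

/-- The basis of `𝔞` formed by the fields `ξ_{f_(m-j,m)}`, `0 ≤ j < m < n`. -/
noncomputable def lieABasis (n : ℕ) : Module.Basis (FieldIndex n) ℂ (lieA n) :=
  (Module.Basis.span (linearIndependent_ham_basisPoly n)).map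
    (LinearEquiv.ofEq _ _ (lieA_eq_span n).symm)

theorem lieABasis_equivFun_symm_apply {n : ℕ} (c : FieldIndex n → ℂ) (x : Mat n) :
    ((lieABasis n).equivFun.symm c : VField n) x = ∑ κ, c κ • ham (basisPoly κ) x := by
  rw [Module.Basis.equivFun_symm_apply, AddSubmonoidClass.coe_finsetSum, Finset.sum_apply]
  refine Finset.sum_congr rfl fun κ _ => ?_
  rw [Submodule.coe_smul, Pi.smul_apply]
  congr 2
  simp [lieABasis, Module.Basis.span_apply]

theorem card_fieldIndex (n : ℕ) : Fintype.card (FieldIndex n) = n * (n - 1) / 2 := by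
  rw [Fintype.card_sigma]
  simp only [Fintype.card_fin]
  rw [Fin.sum_univ_eq_sum_range (fun i => i) n, Finset.sum_range_id]

/-! ### Reparametrized actions -/

theorem differentiable_ham {n : ℕ} (p : Poly n) : Differentiable ℂ (ham p) := by
  refine differentiable_pi.mpr fun s => differentiable_pi.mpr fun t => ?_
  exact fun x => (hasFDerivAt_evalAt _ x).differentiableAt

/-- Pulling back an action along a linear map of vector groups. -/
theorem IsHolAction.comp_linear {W W' : Type*} [NormedAddCommGroup W] [NormedSpace ℂ W]
    [NormedAddCommGroup W'] [NormedSpace ℂ W'] {n : ℕ} {σ : W → Mat n → Mat n}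
    (hσ : IsHolAction σ) (L : W' →L[ℂ] W) : IsHolAction (fun a => σ (L a)) where
  zero x := by simp only [map_zero, hσ.zero]
  add a b x := by simp only [map_add, hσ.add]
  holo q := (hσ.holo (L q.1, q.2)).comp_of_eq (f := fun q : W' × Mat n => (L q.1, q.2))
    (((L.analyticAt _).comp analyticAt_fst).prod analyticAt_snd) rfl

theorem IsHolAction.orbitDeriv_comp_linear {W W' : Type*} [NormedAddCommGroup W]
    [NormedSpace ℂ W] [NormedAddCommGroup W'] [NormedSpace ℂ W'] {n : ℕ} {σ : W → Mat n → Mat n}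
    (hσ : IsHolAction σ) (L : W' →L[ℂ] W) (x : Mat n) (a : W') :
    orbitDeriv (fun a => σ (L a)) x a = orbitDeriv σ x (L a) := by
  refine (hσ.comp_linear L).orbitDeriv_eq ?_
  simp only [map_smul]
  simpa [hσ.zero] using hσ.hasDerivAt_smul (L a) x 0

/-- `σ` is the action of the vector group with coordinates indexed by the basis of `𝔞` whose
coordinate axes are the flows of the basis fields. The consequences that `σ c` has velocity
`∑ κ, c κ • ξ_κ` and leaves the functions in `J(n)` invariant are recorded as fields. -/
structure IsBasisAction {n : ℕ} (σ : (FieldIndex n → ℂ) → Mat n → Mat n) : Prop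
    extends IsHolAction σ where
  single : ∀ κ z x, σ (Pi.single κ z) x = flow κ.1 κ.2 z x
  orbitDeriv_apply : ∀ x c, orbitDeriv σ x c = ∑ κ, c κ • ham (basisPoly κ) x
  invariant : ∀ p ∈ J n, ∀ c x, evalAt (σ c x) p = evalAt x p

theorem exists_isBasisAction (n : ℕ) :
    ∃ σ : (FieldIndex n → ℂ) → Mat n → Mat n, IsBasisAction σ := by
  obtain ⟨σ, h1, h2, h3⟩ := exists_basis_action n
  refine ⟨σ, ⟨h1, h2, fun x c => ?_, fun p hp c x => ?_⟩⟩
  · obtain ⟨D, hD, hD'⟩ := hasFDerivAt_basis_action h1 h2 x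
    rw [orbitDeriv, hD.fderiv, hD']
  · exact h3 (fun y => evalAt y p = evalAt x p)
      (fun κ z y hy => (evalAt_flow hp _ _ z y).trans hy) c x rfl

namespace IsBasisAction

variable {n : ℕ} {σ : (FieldIndex n → ℂ) → Mat n → Mat n}

theorem V_eq_range (hσ : IsBasisAction σ) (x : Mat n) : V x = Set.range (orbitDeriv σ x) := by
  apply Set.Subset.antisymm
  · rintro _ ⟨p, hp, rfl⟩
    obtain ⟨c, _, hc⟩ := exists_ham_eq_sum hp
    exact ⟨fun κ => evalAt x (c κ), by rw [hσ.orbitDeriv_apply, hc]⟩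
  · rintro _ ⟨c, rfl⟩
    refine ⟨∑ κ, c κ • basisPoly κ, sum_mem fun κ _ => (J n).smul_mem (basisPoly_mem_J κ) _, ?_⟩
    rw [hσ.orbitDeriv_apply, ← hamL_apply, map_sum, Finset.sum_apply]
    exact Finset.sum_congr rfl fun κ _ => by rw [map_smul]; rfl

/-- The action preserves the fibers `M_c(n)`. -/
theorem Phi_apply (hσ : IsBasisAction σ) (c : FieldIndex n → ℂ) (x : Mat n) :
    Phi (σ c x) = Phi x := by
  funext i
  obtain ⟨⟨k, m⟩, hk, hkm, hm⟩ := i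
  have h : ∀ y : Mat n, (cutoff hm y).charpoly.coeff (k - 1) =
      evalAt y (incl hm ((Matrix.mvPolynomialX (Fin m) (Fin m) ℂ).charpoly.coeff (k - 1))) := by
    intro y
    rw [evalAt_incl, evalAt_charpoly_coeff, Equiv.apply_symm_apply]
  simp only [Phi, h]
  rw [hσ.invariant _ (incl_charpoly_coeff_mem_J (hk.trans hkm) hm _)]

/-- The fields of a finite family in `J(n)` integrate to an action of a vector group. It moves
points by `σ`, with parameters depending on the point through the invariant functions in `J(n)`. -/
theorem exists_reparametrization (hσ : IsBasisAction σ) {ι : Type*} [Fintype ι] (q : ι → Poly n)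
    (hq : ∀ i, q i ∈ J n) :
    ∃ τ : (ι → ℂ) → Mat n → Mat n, IsHolAction τ ∧
      (∀ x b, orbitDeriv τ x b = ∑ i, b i • ham (q i) x) ∧
      (∀ b x, ∃ c, τ b x = σ c x ∧ orbitDeriv τ x b = orbitDeriv σ x c) ∧
      ∀ b c x, τ b (σ c x) = σ c (τ b x) := by
  choose c hcJ hc using fun i => exists_ham_eq_sum (hq i)
  let C : (ι → ℂ) → Mat n → FieldIndex n → ℂ := fun b x κ => ∑ i, b i * evalAt x (c i κ)
  have hCadd : ∀ a b x, C (a + b) x = C a x + C b x := by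
    intro a b x; funext κ
    simp [C, add_mul, Finset.sum_add_distrib]
  have hCinv : ∀ b a x, C b (σ a x) = C b x := by
    intro b a x; funext κ
    exact Finset.sum_congr rfl fun i _ => by rw [hσ.invariant _ (hcJ i κ)]
  have hC0 : ∀ x, C 0 x = 0 := by
    intro x; funext κ; simp [C]
  have hCsmul : ∀ (z : ℂ) b x, C (z • b) x = z • C b x := by
    intro z b x; funext κ
    simp [C, Finset.mul_sum, mul_assoc]
  have hCan : ∀ p : (ι → ℂ) × Mat n, AnalyticAt ℂ (fun p : (ι → ℂ) × Mat n => C p.1 p.2) p := by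
    intro p
    rw [analyticAt_pi_iff]
    intro κ
    refine Finset.analyticAt_fun_sum _ fun i _ => ?_
    exact (((ContinuousLinearMap.proj (R := ℂ) (φ := fun _ : ι => ℂ) i).analyticAt _).comp
      analyticAt_fst).mul ((analyticAt_evalAt (c i κ) p.2).comp analyticAt_snd)
  have hτ : IsHolAction fun b x => σ (C b x) x := by
    refine ⟨fun x => ?_, fun a b x => ?_, fun p => ?_⟩
    · simp only [hC0, hσ.zero]
    · simp only [hCadd, hCinv, hσ.add]
    · exact (hσ.holo (C p.1 p.2, p.2)).comp_of_eq
        (f := fun p : (ι → ℂ) × Mat n => (C p.1 p.2, p.2)) ((hCan p).prod analyticAt_snd) rfl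
  have hτσ : ∀ b x, orbitDeriv (fun b x => σ (C b x) x) x b = orbitDeriv σ x (C b x) := by
    intro b x
    refine hτ.orbitDeriv_eq ?_
    simp only [hCsmul]
    simpa [hσ.zero] using hσ.hasDerivAt_smul (C b x) x 0
  refine ⟨_, hτ, fun x b => ?_, fun b x => ⟨C b x, rfl, hτσ b x⟩, fun b a x => ?_⟩
  · rw [hτσ, hσ.orbitDeriv_apply]
    simp only [hc, C, Finset.sum_smul, Finset.smul_sum, mul_smul]
    exact Finset.sum_comm
  · simp only [hCinv]
    exact hσ.comm _ _ _

/-- If the velocities of the reparametrized action span the spaces `V x`, it has the same orbits: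
the parameters agree up to an infinitesimal stabilizer, which fixes the point. -/
theorem range_eq_of_reparametrization (hσ : IsBasisAction σ) {W : Type*} {τ : W → Mat n → Mat n}
    {X : Mat n → W → Mat n} (hX : ∀ b x, ∃ c, τ b x = σ c x ∧ X x b = orbitDeriv σ x c)
    (hV : ∀ x, V x ⊆ Set.range (X x)) (x : Mat n) :
    (Set.range fun b => τ b x) = Set.range fun c => σ c x := by
  apply Set.Subset.antisymm
  · rintro _ ⟨b, rfl⟩
    obtain ⟨c, hc, _⟩ := hX b x
    exact ⟨c, hc.symm⟩
  · rintro _ ⟨a, rfl⟩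
    have h1 : orbitDeriv σ x a ∈ V x := by rw [hσ.V_eq_range]; exact ⟨a, rfl⟩
    obtain ⟨b, hb⟩ := hV x h1
    obtain ⟨c, hc, hc'⟩ := hX b x
    refine ⟨b, ?_⟩
    have h2 : orbitDeriv σ x (a - c) = 0 := by rw [map_sub, ← hc', hb, sub_self]
    change τ b x = σ a x
    rw [hc, ← add_sub_cancel c a, hσ.add, hσ.apply_eq_of_orbitDeriv_eq_zero h2]

end IsBasisAction

theorem IsHolAction.analyticOnNhd {W : Type*} [NormedAddCommGroup W] [NormedSpace ℂ W] {n : ℕ}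
    {σ : W → Mat n → Mat n} (hσ : IsHolAction σ) :
    AnalyticOnNhd ℂ (fun q : W × Mat n => σ q.1 q.2) Set.univ := fun q _ => hσ.holo q

/-- If a family of polynomials generates `J(n)`, their Hamiltonian fields span the `V x`. -/
theorem exists_mem_span_ham_of_adjoin_eq {n d : ℕ} {p : Fin d → Poly n}
    (hp : Algebra.adjoin ℂ (Set.range p) = J n) {x v : Mat n} (hv : v ∈ V x) :
    ∃ ξ ∈ Submodule.span ℂ (Set.range fun i => ham (p i)), ξ x = v := by
  obtain ⟨q, hq, rfl⟩ := hv
  rw [← hp] at hq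
  induction hq using Algebra.adjoin_induction with
  | mem q hq =>
    obtain ⟨i, rfl⟩ := hq
    exact ⟨_, Submodule.subset_span ⟨i, rfl⟩, rfl⟩
  | algebraMap r => exact ⟨0, zero_mem _, by rw [MvPolynomial.algebraMap_eq, ham_C]⟩
  | add a b _ _ ha hb =>
    obtain ⟨ξ, hξ, hξ'⟩ := ha
    obtain ⟨η, hη, hη'⟩ := hb
    exact ⟨ξ + η, add_mem hξ hη, by rw [ham_add, Pi.add_apply, Pi.add_apply, hξ', hη']⟩
  | mul a b _ _ ha hb =>
    obtain ⟨ξ, hξ, hξ'⟩ := ha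
    obtain ⟨η, hη, hη'⟩ := hb
    exact ⟨evalAt x a • η + evalAt x b • ξ,
      add_mem (Submodule.smul_mem _ _ hη) (Submodule.smul_mem _ _ hξ), by
        rw [ham_mul, Pi.add_apply, Pi.smul_apply, Pi.smul_apply, hξ', hη']⟩

/-! ### Conjugation by diagonal matrices -/

/-- Two actions of a vector group agree if they agree on the coordinate axes. -/
theorem action_ext {ι : Type*} [Fintype ι] [DecidableEq ι] {α : Type*} {f g : (ι → ℂ) → α → α}
    (hf0 : ∀ x, f 0 x = x) (hg0 : ∀ x, g 0 x = x) (hf : ∀ a b x, f (a + b) x = f a (f b x))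
    (hg : ∀ a b x, g (a + b) x = g a (g b x))
    (h : ∀ i z x, f (Pi.single i z) x = g (Pi.single i z) x) (c : ι → ℂ) (x : α) :
    f c x = g c x := by
  have key : ∀ s : Finset ι, f (∑ i ∈ s, Pi.single i (c i)) x =
      g (∑ i ∈ s, Pi.single i (c i)) x := by
    intro s
    induction s using Finset.induction with
    | empty => rw [Finset.sum_empty, hf0, hg0]
    | insert k s hk ih => rw [Finset.sum_insert hk, hf, hg, ih, h]
  simpa only [Finset.univ_sum_single] using key Finset.univ

/-- The directions of `𝔞` given by the functions `tr x_m`, `1 ≤ m < n`. -/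
def torusDirection (n : ℕ) : (Fin (n - 1) → ℂ) →ₗ[ℂ] (FieldIndex n → ℂ) where
  toFun t κ := if κ.2.val = 0 then t ⟨κ.1.val - 1, by
    have := κ.2.isLt; have := κ.1.isLt; omega⟩ else 0
  map_add' s t := by funext κ; simp only [Pi.add_apply]; split_ifs <;> simp
  map_smul' z t := by funext κ; simp only [Pi.smul_apply, RingHom.id_apply]; split_ifs <;> simp

theorem torusDirection_injective (n : ℕ) : Function.Injective (torusDirection n) := by
  intro s t h
  funext k
  have := congrFun h ⟨⟨k.val + 1, by omega⟩, ⟨0, Nat.succ_pos _⟩⟩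
  simpa [torusDirection] using this

theorem torusDirection_single {n : ℕ} (k : Fin (n - 1)) (z : ℂ) :
    torusDirection n (Pi.single k z) =
      Pi.single (⟨⟨k.val + 1, by omega⟩, ⟨0, Nat.succ_pos _⟩⟩ : FieldIndex n) z := by
  funext κ
  obtain ⟨⟨m, hm⟩, ⟨j, hj⟩⟩ := κ
  simp only at hj
  simp only [torusDirection, LinearMap.coe_mk, AddHom.coe_mk, Pi.single_apply]
  by_cases h : j = 0 ∧ m = k.val + 1
  · obtain ⟨rfl, rfl⟩ := h
    simp
  · have h2 : ¬ ((⟨⟨m, hm⟩, ⟨j, hj⟩⟩ : FieldIndex n) =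
        ⟨⟨k.val + 1, by omega⟩, ⟨0, Nat.succ_pos _⟩⟩) := by
      intro h'
      have e1 := congrArg (fun κ : FieldIndex n => κ.1.val) h'
      have e2 := congrArg (fun κ : FieldIndex n => κ.2.val) h'
      exact h ⟨e2, e1⟩
    rw [if_neg h2]
    split_ifs with h3 h4
    · have := congrArg Fin.val h4
      simp only at this
      omega
    · rfl
    · rfl

/-- The invertible diagonal matrix by which the torus direction `t` acts. -/
noncomputable def torusElement {n : ℕ} (t : Fin (n - 1) → ℂ) : GL (Fin n) ℂ :=
  expUnit (Matrix.diagonal fun i => ∑ k, if i.val ≤ k.val then t k else 0)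

theorem torusElement_add {n : ℕ} (s t : Fin (n - 1) → ℂ) :
    torusElement (n := n) (s + t) = torusElement s * torusElement t := by
  rw [torusElement, torusElement, torusElement, ← expUnit_add (Matrix.commute_diagonal _ _),
    Matrix.diagonal_add]
  congr 2
  funext i
  rw [← Finset.sum_add_distrib]
  exact Finset.sum_congr rfl fun k _ => by split_ifs <;> simp

theorem torusElement_zero {n : ℕ} : torusElement (n := n) 0 = 1 := by
  rw [torusElement, ← expUnit_zero]
  simp

theorem isDiag_torusElement {n : ℕ} (t : Fin (n - 1) → ℂ) :
    (torusElement t : Matrix (Fin n) (Fin n) ℂ).IsDiag := by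
  change (NormedSpace.exp (Matrix.diagonal _)).IsDiag
  rw [Matrix.exp_diagonal]
  exact Matrix.isDiag_diagonal _

theorem IsBasisAction.torusDirection_apply {n : ℕ} {σ : (FieldIndex n → ℂ) → Mat n → Mat n}
    (hσ : IsBasisAction σ) (t : Fin (n - 1) → ℂ) (x : Mat n) :
    σ (torusDirection n t) x = Ad (torusElement t) x := by
  refine action_ext (f := fun t => σ (torusDirection n t)) (g := fun t => Ad (torusElement t))
    ?_ ?_ ?_ ?_ ?_ t x
  · intro x; simp only [map_zero, hσ.zero]
  · intro x; simp only [torusElement_zero, Ad_one]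
  · intro a b x; simp only [map_add, hσ.add]
  · intro a b x; simp only [torusElement_add, Ad_mul]
  · intro k z x
    rw [torusDirection_single, hσ.single, flow, blockPow_zero, torusElement]
    congr 2
    rw [blockProj, ← Matrix.diagonal_smul]
    congr 1
    funext i
    rw [Finset.sum_eq_single k]
    · simp
    · intro b _ hb; simp [hb]
    · simp

theorem sum_telescope_from (a : ℕ → ℂ) {i N : ℕ} (h : i ≤ N) :
    (∑ k ∈ Finset.range N, if i ≤ k then a k - a (k + 1) else 0) = a i - a N := by
  induction N, h using Nat.le_induction with
  | base =>
    rw [sub_self]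
    refine Finset.sum_eq_zero fun k hk => if_neg ?_
    rw [Finset.mem_range] at hk; omega
  | succ N h ih => rw [Finset.sum_range_succ, ih, if_pos h]; ring

/-- Every invertible diagonal matrix acts as a torus element: scalars act trivially, so the last
diagonal entry can be normalized to `1`. -/
theorem exists_torusElement {n : ℕ} {g : GL (Fin n) ℂ}
    (hg : (g : Matrix (Fin n) (Fin n) ℂ).IsDiag) :
    ∃ t : Fin (n - 1) → ℂ, ∀ x : Mat n, Ad (torusElement t) x = Ad g x := by
  have hne : ∀ i, (g : Matrix (Fin n) (Fin n) ℂ) i i ≠ 0 := by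
    intro i hi
    have h1 := congrFun (congrFun g.mul_inv i) i
    rw [← hg.diagonal_diag, Matrix.diagonal_mul, Matrix.diag_apply, hi, zero_mul,
      Matrix.one_apply_eq] at h1
    exact zero_ne_one h1
  let a : ℕ → ℂ := fun k =>
    if h : k < n then Complex.log ((g : Matrix (Fin n) (Fin n) ℂ) ⟨k, h⟩ ⟨k, h⟩) else 0
  refine ⟨fun k => a k - a (k + 1), fun x => ?_⟩
  have h1 : expUnit (Matrix.diagonal fun i : Fin n => a i) = g := by
    refine Units.ext ?_
    change NormedSpace.exp (Matrix.diagonal _) = _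
    rw [Matrix.exp_diagonal, ← hg.diagonal_diag]
    congr 1
    funext i
    rw [Pi.coe_exp, ← Complex.exp_eq_exp_ℂ]
    simp only [a, i.isLt, dif_pos, Matrix.diag_apply]
    exact Complex.exp_log (hne i)
  have h2 : (Matrix.diagonal fun i : Fin n => ∑ k : Fin (n - 1),
      if i.val ≤ k.val then a k - a (k + 1) else 0) =
      (Matrix.diagonal fun i : Fin n => a i) + (-a (n - 1)) • (1 : Matrix (Fin n) (Fin n) ℂ) := by
    rw [Matrix.smul_one_eq_diagonal, Matrix.diagonal_add]
    congr 1
    funext i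
    rw [Fin.sum_univ_eq_sum_range (fun k => if i.val ≤ k then a k - a (k + 1) else 0),
      sum_telescope_from a (by omega)]
    ring
  rw [torusElement, h2, expUnit_add ((Commute.one_right _).smul_right _), h1, Ad_mul]
  congr 1
  apply Matrix.of.injective
  have h3 : Commute (expUnit ((-a (n - 1)) • (1 : Matrix (Fin n) (Fin n) ℂ))).val (Matrix.of x) :=
    commute_expUnit ((Commute.one_left _).smul_left _)
  rw [of_Ad, h3.eq, mul_assoc, Units.mul_inv, mul_one]

end GelfandZeitlin

theorem theorem3p4 (n : ℕ) (hn : 1 ≤ n) :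
    -- `J(n)` is a maximal Poisson commutative subalgebra of `P(n)`
    (∀ p ∈ J n, ∀ q ∈ J n, poisson p q = 0) ∧
    (∀ f : Poly n, (∀ p ∈ J n, poisson f p = 0) → f ∈ J n) ∧
    -- `𝔞` is a commutative Lie algebra of dimension `d(n-1)`
    Module.Finite ℂ (lieA n) ∧
    Module.finrank ℂ (lieA n) = n * (n - 1) / 2 ∧
    (∀ ξ ∈ lieA n, ∀ η ∈ lieA n, VectorField.lieBracket ℂ ξ η = 0) ∧
    -- the group `A = ℂ^{d(n-1)}` with Lie algebra `𝔞`
    ∀ e : (Fin (n * (n - 1) / 2) → ℂ) ≃ₗ[ℂ] lieA n,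
      ∃ σ : (Fin (n * (n - 1) / 2) → ℂ) → Mat n → Mat n,
        Integrates (lieA n) e σ ∧
        (∀ x, IsLeaf (orbit σ x)) ∧
        (∀ (c : Index n → ℂ) (a : Fin (n * (n - 1) / 2) → ℂ), ∀ x ∈ fiber c, σ a x ∈ fiber c) ∧
        -- `Ad D(n)` is the group of transformations given by an `n-1` dimensional subgroup of `A`
        (∃ D : Submodule ℂ (Fin (n * (n - 1) / 2) → ℂ), Module.finrank ℂ D = n - 1 ∧
          {T : Mat n → Mat n | ∃ a ∈ D, T = σ a} =
            {T : Mat n → Mat n | ∃ g : GL (Fin n) ℂ,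
              (g : Matrix (Fin n) (Fin n) ℂ).IsDiag ∧ T = Ad g}) ∧
        -- the flow of `ξ_p`, for `p ∈ J(n)`
        (∀ p ∈ J n, ∃ φ : ℂ → Mat n → Mat n,
          IsFlow (ham p) φ ∧
          (∀ z a x, φ z (σ a x) = σ a (φ z x)) ∧
          (∀ z x, ∀ y ∈ orbit σ x, φ z y ∈ orbit σ x) ∧
          (∀ (c : Index n → ℂ) (z : ℂ), ∀ x ∈ fiber c, φ z x ∈ fiber c)) ∧
        -- arbitrary finite sets of generators of `J(n)`
        (∀ (d : ℕ) (p' : Fin d → Poly n), Algebra.adjoin ℂ (Set.range p') = J n →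
          (∀ ξ ∈ Submodule.span ℂ (Set.range fun i => ham (p' i)),
            ∀ η ∈ Submodule.span ℂ (Set.range fun i => ham (p' i)),
              VectorField.lieBracket ℂ ξ η = 0) ∧
          ∀ (r : ℕ) (e' : (Fin r → ℂ) ≃ₗ[ℂ] Submodule.span ℂ (Set.range fun i => ham (p' i))),
            ∃ τ : (Fin r → ℂ) → Mat n → Mat n,
              Integrates (Submodule.span ℂ (Set.range fun i => ham (p' i))) e' τ ∧
              (∀ b a x, τ b (σ a x) = σ a (τ b x)) ∧
              (∀ x, orbit τ x = orbit σ x) ∧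
              (∀ x, IsLeaf (orbit τ x))) := by
  obtain ⟨σ₀, hσ₀⟩ := exists_isBasisAction n
  have hfin : Module.Finite ℂ (lieA n) := Module.Finite.of_basis (lieABasis n)
  refine ⟨fun p hp q hq => poisson_eq_zero_of_mem_J hp hq, fun f hf => mem_J_of_poisson_eq_zero hf,
    hfin, ?_, ?_, ?_⟩
  · rw [Module.finrank_eq_card_basis (lieABasis n), card_fieldIndex]
  · intro ξ hξ η hη
    have hmem : ∀ ξ ∈ lieA n, ∃ c, (∀ x, orbitDeriv σ₀ x c = ξ x) ∧ Differentiable ℂ ξ := by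
      intro ξ hξ
      refine ⟨(lieABasis n).equivFun ⟨ξ, hξ⟩, fun x => ?_, ?_⟩
      · rw [hσ₀.orbitDeriv_apply, ← lieABasis_equivFun_symm_apply, LinearEquiv.symm_apply_apply]
      · induction hξ using Submodule.span_induction with
        | mem ξ h => obtain ⟨k, m, h, _, _, rfl⟩ := h; exact differentiable_ham _
        | zero => exact differentiable_const _
        | add ξ η _ _ h1 h2 => exact h1.add h2
        | smul z ξ _ h1 => exact h1.const_smul z
    obtain ⟨a, ha, ha'⟩ := hmem ξ hξ
    obtain ⟨b, hb, hb'⟩ := hmem η hη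
    exact hσ₀.lieBracket_eq_zero ha hb ha' hb'
  intro e
  -- The group with Lie algebra coordinates `e` acts by `σ₀` in the coordinates of the basis of `𝔞`.
  let L : (Fin (n * (n - 1) / 2) → ℂ) ≃ₗ[ℂ] (FieldIndex n → ℂ) := e.trans (lieABasis n).equivFun
  let Lc : (Fin (n * (n - 1) / 2) → ℂ) →L[ℂ] (FieldIndex n → ℂ) :=
    LinearMap.toContinuousLinearMap L.toLinearMap
  have hL : ∀ a, Lc a = L a := fun _ => rfl
  have hσ := hσ₀.comp_linear Lc
  have horb : ∀ x, orbit (fun a => σ₀ (Lc a)) x = Set.range fun c => σ₀ c x := by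
    intro x
    exact L.surjective.range_comp fun c => σ₀ c x
  have hleaf : ∀ x, IsLeaf (Set.range fun c => σ₀ c x) :=
    hσ₀.isLeaf_range hσ₀.V_eq_range
  refine ⟨fun a => σ₀ (Lc a), ⟨hσ.zero, hσ.add, hσ.analyticOnNhd, fun a x => ?_⟩, fun x => ?_,
    fun c a x hx => (hσ₀.Phi_apply _ _).trans hx, ?_, ?_, ?_⟩
  · have h := hσ.hasDerivAt_smul a x 0
    rw [zero_smul, hσ.zero, hσ₀.orbitDeriv_comp_linear, hσ₀.orbitDeriv_apply,
      ← lieABasis_equivFun_symm_apply, hL] at h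
    simpa [L] using h
  · rw [horb]; exact hleaf x
  · refine ⟨LinearMap.range (L.symm.toLinearMap ∘ₗ torusDirection n), ?_, ?_⟩
    · rw [LinearMap.finrank_range_of_inj]
      · simp
      · exact L.symm.injective.comp (torusDirection_injective n)
    · have hT : ∀ t, (fun x => σ₀ (Lc (L.symm (torusDirection n t))) x) = Ad (torusElement t) := by
        intro t
        funext x
        rw [hL, LinearEquiv.apply_symm_apply, hσ₀.torusDirection_apply]
      apply Set.Subset.antisymm
      · rintro _ ⟨_, ⟨t, rfl⟩, rfl⟩
        exact ⟨torusElement t, isDiag_torusElement t, hT t⟩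
      · rintro _ ⟨g, hg, rfl⟩
        obtain ⟨t, ht⟩ := exists_torusElement hg
        exact ⟨_, ⟨t, rfl⟩, (funext fun x => (ht x).symm).trans (hT t).symm⟩
  · intro p hp
    obtain ⟨τ, hτ, hτX, hτσ, hτc⟩ := hσ₀.exists_reparametrization (fun _ : Unit => p) fun _ => hp
    let ℓ : ℂ →L[ℂ] (Unit → ℂ) := ContinuousLinearMap.pi fun _ => ContinuousLinearMap.id ℂ ℂ
    have hφ := hτ.comp_linear ℓ
    refine ⟨fun z => τ (ℓ z), ⟨hφ.zero, hφ.add, hφ.analyticOnNhd, fun x => ?_⟩,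
      fun z a x => hτc _ _ _, ?_, ?_⟩
    · have h := hφ.hasDerivAt_smul 1 x 0
      rw [zero_smul, hφ.zero, hτ.orbitDeriv_comp_linear, hτX] at h
      simpa [ℓ] using h
    · intro z x y hy
      rw [horb] at hy ⊢
      obtain ⟨c, rfl⟩ := hy
      obtain ⟨c', h, _⟩ := hτσ (ℓ z) (σ₀ c x)
      refine ⟨c' + c, ?_⟩
      change σ₀ (c' + c) x = τ (ℓ z) (σ₀ c x)
      rw [h, hσ₀.add]
    · intro c z x hx
      obtain ⟨c', h, _⟩ := hτσ (ℓ z) x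
      change Phi (τ (ℓ z) x) = c
      rw [h, hσ₀.Phi_apply]
      exact hx
  · intro d p' hp'
    have hpJ : ∀ i, p' i ∈ J n := fun i => by
      rw [← hp']; exact Algebra.subset_adjoin ⟨i, rfl⟩
    have hspan : ∀ ξ ∈ Submodule.span ℂ (Set.range fun i => ham (p' i)),
        ∃ b : Fin d → ℂ, ham (∑ i, b i • p' i) = ξ := by
      intro ξ hξ
      obtain ⟨b, hb⟩ := (Submodule.mem_span_range_iff_exists_fun ℂ).mp hξ
      refine ⟨b, ?_⟩
      rw [← hb, ← hamL_apply, map_sum]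
      exact Finset.sum_congr rfl fun i _ => by rw [map_smul, hamL_apply]
    refine ⟨?_, fun r e' => ?_⟩
    · obtain ⟨τ, hτ, hτX, _⟩ := hσ₀.exists_reparametrization p' hpJ
      have hmem : ∀ ξ ∈ Submodule.span ℂ (Set.range fun i => ham (p' i)),
          ∃ b, (∀ x, orbitDeriv τ x b = ξ x) ∧ Differentiable ℂ ξ := by
        intro ξ hξ
        obtain ⟨b, rfl⟩ := hspan ξ hξ
        refine ⟨b, fun x => ?_, differentiable_ham _⟩
        rw [hτX, ← hamL_apply, map_sum, Finset.sum_apply]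
        exact Finset.sum_congr rfl fun i _ => by rw [map_smul]; rfl
      intro ξ hξ η hη
      obtain ⟨a, ha, ha'⟩ := hmem ξ hξ
      obtain ⟨b, hb, hb'⟩ := hmem η hη
      exact hτ.lieBracket_eq_zero ha hb ha' hb'
    -- Reparametrize by polynomials `∑ k, b i k • p' k` whose fields are the images of the unit
    -- vectors under the given identification.
    · choose b hb using fun i : Fin r => hspan (e' (Pi.single i 1)) (e' _).2
      obtain ⟨τ, hτ, hτX, hτσ, hτc⟩ := hσ₀.exists_reparametrization
        (fun i => ∑ k, b i k • p' k)
        fun i => sum_mem fun k _ => (J n).smul_mem (hpJ k) _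
      have hτe : ∀ x a, orbitDeriv τ x a = (e' a : VField n) x := by
        intro x a
        rw [hτX]
        simp only [hb]
        conv_rhs => rw [← Finset.univ_sum_single a, map_sum, AddSubmonoidClass.coe_finsetSum,
          Finset.sum_apply]
        refine Finset.sum_congr rfl fun i _ => ?_
        rw [show (Pi.single i (a i) : Fin r → ℂ) = a i • Pi.single i 1 by
          rw [← Pi.single_smul', smul_eq_mul, mul_one], map_smul, Submodule.coe_smul,
          Pi.smul_apply]
      have hVτ : ∀ x, V x ⊆ Set.range (orbitDeriv τ x) := by
        intro x v hv
        obtain ⟨ξ, hξ, rfl⟩ := exists_mem_span_ham_of_adjoin_eq hp' hv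
        exact ⟨e'.symm ⟨ξ, hξ⟩, by rw [hτe, LinearEquiv.apply_symm_apply]⟩
      have horbτ : ∀ x, orbit τ x = Set.range fun c => σ₀ c x :=
        hσ₀.range_eq_of_reparametrization (X := fun x => orbitDeriv τ x) hτσ hVτ
      refine ⟨τ, ⟨hτ.zero, hτ.add, hτ.analyticOnNhd, fun a x => ?_⟩, fun _ _ _ => hτc _ _ _,
        fun x => ?_, fun x => ?_⟩
      · have h := hτ.hasDerivAt_smul a x 0
        rwa [zero_smul, hτ.zero, hτe] at h
      · rw [horb, horbτ]
      · rw [horbτ]; exact hleaf x
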